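/- **Setting.** Let $G=(V,E)$ be a finite nonempty strongly connected directed graph, $E\subseteq V\times V$, and consider $$\min_{x\in\mathbb R^m}\ \sum_{i\in V}\Big[f_i(x)+\tfrac12\|x-\bar x_i\|^2\Big],\qquad \bar m=\frac1{|V|}\sum_{i\in V}\bar x_i ,$$ where each $f_i:\mathbb R^m\to\mathbb R$ is convex and differentiable and $\nabla f_i$ is Lipschitz with constant $1/\sigma$, $\sigma>0$ (equivalently, $f_i^*$ is strongly convex with modulus $\sigma$). Let $V=V_1\cup V_2$ be a partition, $F=\{\{i,(i,j)\}:(i,j)\in E\}\cup\{\{i,j\}:(i,j)\in E\}$, and for $\beta\in F$ let $H_\beta\subset[\mathbb R^m]^{V\cup E}$ be the subspace of the vectors whose two components in $\beta$ are equal. For functions $g_i$ put $\mathbf g_i(\mathbf x)=g_i([\mathbf x]_i)$. For weights $\mathbf s=(s_\alpha)_{\alpha\in V\cup E}\ge 0$ and dual variables $\mathbf z=(\mathbf z_\alpha)_{\alpha\in V\cup F}$, $\mathbf z_\alpha\in[\mathbb R^m]^{V\cup E}$, put $$F_S(\mathbf z,\mathbf s)=\sum_{i\in V}\mathbf f_i^*(\mathbf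 z_i)+\sum_{\beta\in F}\delta_{H_\beta^\perp}(\mathbf z_\beta)+\sum_{\alpha\in V\cup E}\frac{s_\alpha}{2}\|x_\alpha\|^2,\qquad x_\alpha=\bar m-\frac1{s_\alpha}\Big[\sum_{\alpha_2\in V\cup F}\mathbf z_{\alpha_2}\Big]_\alpha ,$$ where for $s_\alpha=0$ the last term is read as $0$ if $[\sum_{\alpha_2}\mathbf z_{\alpha_2}]_\alpha=0$ and as $+\infty$ otherwise. Let $F_S^*=\inf_{\mathbf z}F_S(\mathbf z,\mathbf s)$. **Algorithm.** A state consists of $y_i,s_i,\sigma_{i,y},\sigma_{i,s},[\mathbf z_i]_i$ for $i\in V$, $\rho_{e,y},\rho_{e,s}$ for $e\in E$, and a function $f_i^k$ for $i\in V_2$; put $y_{(i,j)}=\sigma_{i,y}-\rho_{(i,j),y}$, $s_{(i,j)}=\sigma_{i,s}-\rho_{(i,j),s}$, and $x_\alpha=y_\alpha/s_\alpha$ if $s_\alpha>0$. The initial state is any state with $s_i>0$ for $i\in V$, $s_e\ge0$ for $e\in E$, $\sum_{\alpha\in V\cup E} s_\alpha=|V|$, $y_e=0$ whenever $s_e=0$,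 $\sum_{\alpha\in V\cup E} y_\alpha=|V|\bar m-\sum_{i\in V}[\mathbf z_i]_i$, and, for $i\in V_2$, $f_i^0\le f_i$ affine with gradient $[\mathbf z_i]_i$. (This includes the cold start: $s_i=1$; $\sigma,\rho=0$; $[\mathbf z_i]_i=0$ for $i\in V_1$; and $y_i=y_i'$ for $i\in V_1$, $y_i=y_i'-[\mathbf z_i]_i$ for $i\in V_2$, with $\frac1{|V|}\sum_i y_i'=\bar m$.) The operations are as follows. * $A$ on $i$: $y_i\leftarrow y_i/(\deg_{\rm out}(i)+1)$, $s_i\leftarrow s_i/(\deg_{\rm out}(i)+1)$, then $\sigma_{i,y}\leftarrow\sigma_{i,y}+y_i$, $\sigma_{i,s}\leftarrow\sigma_{i,s}+s_i$. * $B$ on $(i,j)$: $y_j\leftarrow y_j+\sigma_{i,y}-\rho_{(i,j),y}$, $s_j\leftarrow s_j+\sigma_{i,s}-\rho_{(i,j),s}$, then $\rho_{(i,j),y}\leftarrow\sigma_{i,y}$, $\rho_{(i,j),s}\leftarrow\sigma_{i,s}$. * $C$ on $j$: let $x_{\rm temp}=\frac1{s_j}(y_j+[\mathbf z_j]_j)$.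 If $j\in V_1$, let $x^+=\arg\min_x \frac{s_j}{2}\|x-x_{\rm temp}\|^2+f_j(x)$. If $j\in V_2$, let $\tilde f_j(x)=f_j(x_j)+\langle v,x-x_j\rangle$ with $x_j=y_j/s_j$, $v\in\partial f_j(x_j)$, and $x^+=\arg\min_x\max\{f_j^k,\tilde f_j\}(x)+\frac{s_j}2\|x-x_{\rm temp}\|^2$. Then $[\mathbf z_j]_j\leftarrow s_j(x_{\rm temp}-x^+)$, $y_j\leftarrow s_jx^+$ and, if $j\in V_2$, $f_j^k$ is replaced by $x\mapsto\langle[\mathbf z_j]_j,x-x^+\rangle+\max\{f_j^k,\tilde f_j\}(x^+)$ (new $[\mathbf z_j]_j$, old $f_j^k$ inside the maximum). Each iteration $k\to k+1$ performs a finite sequence of operations, every operation at most once. A dual variable $\mathbf z^k$ belongs to iterate $k$ if $\mathbf z^k_i$ has the $i$-th component $[\mathbf z_i]_i$ of the state and all other components zero, $\mathbf z^k_\beta\in H_\beta^\perp$, and $y_\alpha^k=s^k_\alpha\bar m-[\sum_{\alpha_2\in V\cup F}\mathbf z^k_{\alpha_2}]_\alpha$ for all $\alpha\in V\cup E$. Let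 $\tilde F_S^k(\cdot,\mathbf s^k)$ be $F_S(\cdot,\mathbf s^k)$ with $f_i$ replaced by $f_i^k$ for $i\in V_2$. Let $s_{\min},s_{\max}>0$ be such that $s_{\min}\le s^k_\alpha\le s_{\max}$ for all $k\ge0$ and $\alpha\in V\cup E$ with $s^k_\alpha>0$. For an integer $K>0$, call the iterations $k_0\to k_0+1\to\dots\to k_0+K$ a *window* if the first one consists of operation $C$ on all nodes, and for each $(i,j)\in E$ there is $\bar k\in\{1,\dots,K-1\}$ such that iteration $k_0+\bar k\to k_0+\bar k+1$ performs operation $A$ on $i$ and later operation $B$ on $(i,j)$. **Theorem.** For all $G,\sigma,s_{\min},s_{\max},K$ as above there are constants $\gamma_5,\rho\in(0,1)$, depending only on these data, such that for every $m$, all $f_i$, $\bar x_i$, every partition $V=V_1\cup V_2$ and every run of the algorithm as above: 1. $F_S^*$ is finite and is the same for all $\mathbf s^k$, the primal problem has a unique minimizer $x^*$, and to every iterate belongs a dual variable $\mathbf z^k$. 2. If the $K$ iterations starting at $k_0$ form a window, then $$\tilde F_S^{k_0+K}(\mathbf z^{k_0+K},\mathbf s^{k_0+K})-F_S^*\le\gamma_5\big[\tilde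 F_S^{k_0}(\mathbf z^{k_0},\mathbf s^{k_0})-F_S^*\big]$$ for all dual variables $\mathbf z^{k_0},\mathbf z^{k_0+K}$ that belong to these iterates (the values of $\tilde F_S$ may be $+\infty$). 3. For all $k$ and all $\mathbf z^k$ belonging to iterate $k$, $\sum_{\alpha\in V\cup E}\frac{s^k_\alpha}2\|x^*-x^k_\alpha\|^2\le\tilde F_S^k(\mathbf z^k,\mathbf s^k)-F_S^*$. 4. If the $K$ iterations starting at $nK$ form a window for every $n\ge0$, then there is $C$ with $\|x_i^k-x^*\|\le C\rho^k$ for all $k\ge0$ and $i\in V$. -/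

import Mathlib

open scoped BigOperators

namespace DistDyk

noncomputable section

/-- The primal space `ℝ^m` with the Euclidean norm. -/
abbrev X (m : ℕ) : Type := EuclideanSpace ℝ (Fin m)

/-- Strong connectivity of the directed graph with edge set `E`. -/
def StronglyConnected {V : Type*} (E : Finset (V × V)) : Prop :=
  ∀ i j : V, Relation.ReflTransGen (fun a b => (a, b) ∈ E) i j

/-- The index set `V ∪ E` (a disjoint union). -/
abbrev Idx (V : Type*) (E : Finset (V × V)) : Type _ := V ⊕ {e : V × V // e ∈ E}

/-- The product space `[ℝ^m]^{|V ∪ E|}` with its Euclidean structure. -/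
abbrev PVec (V : Type*) (E : Finset (V × V)) (m : ℕ) : Type _ :=
  PiLp 2 (fun _ : Idx V E => X m)

/-- Data of the problem `min_x ∑ i, (f i x + ½ ‖x - xbar i‖²)`; the functions `f i` with
`i ∈ V₁` are treated by their proximal map, those with `i ∉ V₁` by affine minorants. -/
structure Problem (V : Type*) (m : ℕ) where
  f : V → X m → ℝ
  xbar : V → X m
  V₁ : Finset V

section Graph

variable {V : Type*} [Fintype V] [DecidableEq V] {E : Finset (V × V)} {m : ℕ}

/-- The average of the `xbar i`. -/
def Problem.mbar (P : Problem V m) : X m := (Fintype.card V : ℝ)⁻¹ • ∑ i, P.xbar i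

/-- The primal objective. -/
def Problem.objective (P : Problem V m) (x : X m) : ℝ :=
  ∑ i, (P.f i x + 1 / 2 * ‖x - P.xbar i‖ ^ 2)

/-- Every `f i` is convex and differentiable and its gradient is Lipschitz with constant `1/σ`. -/
def Problem.Smooth (P : Problem V m) (σ : ℝ) : Prop :=
  ∀ i, ConvexOn ℝ Set.univ (P.f i) ∧ Differentiable ℝ (P.f i) ∧
    ∀ x y, ‖gradient (P.f i) x - gradient (P.f i) y‖ ≤ 1 / σ * ‖x - y‖

/-! ### The dual problem -/

/-- Fenchel conjugate of a finite function on a real inner product space. -/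
def conj {H : Type*} [NormedAddCommGroup H] [InnerProductSpace ℝ H] (g : H → ℝ) (z : H) : EReal :=
  ⨆ x : H, ((inner ℝ z x - g x : ℝ) : EReal)

open Classical in
/-- Indicator function (`0` on `S`, `+∞` elsewhere). -/
def indic {H : Type*} [NormedAddCommGroup H] [InnerProductSpace ℝ H] (S : Submodule ℝ H) (z : H) :
    EReal :=
  if z ∈ S then 0 else ⊤

/-- The set `F` of unordered pairs `{i, (i,j)}` and `{i, j}` for `(i,j) ∈ E`. -/
def pairs (E : Finset (V × V)) : Finset (Sym2 (Idx V E)) :=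
  Finset.univ.image (fun e : {e : V × V // e ∈ E} =>
      s((Sum.inl e.1.1 : Idx V E), (Sum.inr e : Idx V E))) ∪
    Finset.univ.image (fun e : {e : V × V // e ∈ E} =>
      s((Sum.inl e.1.1 : Idx V E), (Sum.inl e.1.2 : Idx V E)))

/-- The subspace `H_β` of the vectors whose components in `β` coincide. -/
def hyper (m : ℕ) (β : Sym2 (Idx V E)) : Submodule ℝ (PVec V E m) where
  carrier := {x | ∀ a ∈ β, ∀ b ∈ β, x a = x b}
  add_mem' := by
    intro x y hx hy a ha b hb
    simp [hx a ha b hb, hy a ha b hb]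
  zero_mem' := by
    intro a _ b _
    simp
  smul_mem' := by
    intro c x hx a ha b hb
    simp [hx a ha b hb]

/-- Dual variables: one vector of the product space for every element of `V` and of `F`. -/
structure DualVar (V : Type*) [Fintype V] [DecidableEq V] (E : Finset (V × V)) (m : ℕ) where
  node : V → PVec V E m
  pair : {β : Sym2 (Idx V E) // β ∈ pairs E} → PVec V E m

/-- The sum of all the components of a dual variable. -/
def DualVar.total (z : DualVar V E m) : PVec V E m := ∑ i, z.node i + ∑ β, z.pair β

open Classical in
/-- The term `(s/2) ‖x‖²` as a function of `s ≥ 0` and `y = s x`. For `s = 0` this is the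
conjugate of the zero function, i.e. the indicator of `y = 0`. -/
def quad (s : ℝ) (y : X m) : EReal :=
  if s = 0 then (if y = 0 then 0 else ⊤) else ((s / 2 * ‖s⁻¹ • y‖ ^ 2 : ℝ) : EReal)

/-- The dual objective
`∑ i, 𝐠ᵢ^*(zᵢ) + ∑ β, δ_{H_β^⊥}(z_β) + ∑ α, (s_α/2) ‖mbar - [∑ z]_α / s_α‖²`,
where `𝐠ᵢ(𝐱) = gᵢ([𝐱]ᵢ)` on the product space. -/
def dualObj (g : V → X m → ℝ) (mbar : X m) (s : Idx V E → ℝ) (z : DualVar V E m) : EReal :=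
  ∑ i, conj (fun x : PVec V E m => g i (x (Sum.inl i))) (z.node i) +
    ∑ β, indic (hyper m β.1)ᗮ (z.pair β) +
    ∑ α, quad (s α) (s α • mbar - z.total α)

/-- The optimal value of the dual problem with weights `s`. -/
def dualOpt (P : Problem V m) (s : Idx V E → ℝ) : EReal :=
  ⨅ z : DualVar V E m, dualObj P.f P.mbar s z

/-! ### The algorithm -/

/-- The data carried by the algorithm. The function `fa i` is the affine minorant of `f i`, used
only for `i ∉ V₁`; `z i` stands for `[𝐳ᵢ]ᵢ`. -/
structure State (V : Type*) (E : Finset (V × V)) (m : ℕ) where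
  y : V → X m
  s : V → ℝ
  sigY : V → X m
  sigS : V → ℝ
  rhoY : {e : V × V // e ∈ E} → X m
  rhoS : {e : V × V // e ∈ E} → ℝ
  z : V → X m
  fa : V → X m → ℝ

namespace State

/-- `y_α` for `α ∈ V ∪ E`; on an edge it is the data sent but not yet received. -/
def yAll (st : State V E m) : Idx V E → X m
  | Sum.inl i => st.y i
  | Sum.inr e => st.sigY e.1.1 - st.rhoY e

/-- `s_α` for `α ∈ V ∪ E`. -/
def sAll (st : State V E m) : Idx V E → ℝ
  | Sum.inl i => st.s i
  | Sum.inr e => st.sigS e.1.1 - st.rhoS e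

/-- The primal value `x_α = y_α / s_α`, of use only where `s_α > 0`. -/
def x (st : State V E m) (α : Idx V E) : X m := (st.sAll α)⁻¹ • st.yAll α

/-- The functions of the majorized dual objective: `f i` for `i ∈ V₁`, the current affine minorant
otherwise. -/
def maj (P : Problem V m) (st : State V E m) (i : V) : X m → ℝ :=
  if i ∈ P.V₁ then P.f i else st.fa i

/-- The full dual variable `z` belongs to the state: `zᵢ` has the only nonzero component
`[zᵢ]ᵢ` carried by the algorithm, `z_β ∈ H_β^⊥`, and `y_α = s_α mbar - [∑ z]_α`. -/
def Represents (P : Problem V m) (st : State V E m) (z : DualVar V E m) : Prop :=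
  (∀ i, z.node i (Sum.inl i) = st.z i) ∧
  (∀ i α, α ≠ Sum.inl i → z.node i α = 0) ∧
  (∀ β, z.pair β ∈ (hyper m β.1)ᗮ) ∧
  (∀ α, st.yAll α = st.sAll α • P.mbar - z.total α)

/-- The majorized dual objective of the state at the dual variable `z`. -/
def majObj (P : Problem V m) (st : State V E m) (z : DualVar V E m) : EReal :=
  dualObj (st.maj P) P.mbar st.sAll z

/-- The states from which the algorithm may be started or resumed: the weights are nonnegative,
positive on nodes, of sum `|V|`; an edge without weight carries no data; the `y_α` have the sum
that the dual variables prescribe; and `fa i` is an affine minorant of `f i` with gradient `z i`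
for `i ∉ V₁`. -/
structure Admissible (P : Problem V m) (st : State V E m) : Prop where
  s_pos : ∀ i, 0 < st.s i
  s_nonneg : ∀ α, 0 ≤ st.sAll α
  s_sum : ∑ α, st.sAll α = Fintype.card V
  y_zero : ∀ α, st.sAll α = 0 → st.yAll α = 0
  y_sum : ∑ α, st.yAll α = (Fintype.card V : ℝ) • P.mbar - ∑ i, st.z i
  affine : ∀ i, i ∉ P.V₁ → ∃ b : ℝ, ∀ x, st.fa i x = inner ℝ (st.z i) x + b
  minorant : ∀ i, i ∉ P.V₁ → ∀ x, st.fa i x ≤ P.f i x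

/-- The cold start of the algorithm. -/
structure ColdStart (P : Problem V m) (st : State V E m) : Prop where
  start : ∃ y0 : V → X m, (Fintype.card V : ℝ)⁻¹ • ∑ i, y0 i = P.mbar ∧
    ∀ i, st.y i = if i ∈ P.V₁ then y0 i else y0 i - st.z i
  s_one : ∀ i, st.s i = 1
  sig : ∀ i, st.sigY i = 0 ∧ st.sigS i = 0
  rho : ∀ e, st.rhoY e = 0 ∧ st.rhoS e = 0
  z_zero : ∀ i ∈ P.V₁, st.z i = 0
  affine : ∀ i, i ∉ P.V₁ → ∃ b : ℝ, ∀ x, st.fa i x = inner ℝ (st.z i) x + b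
  minorant : ∀ i, i ∉ P.V₁ → ∀ x, st.fa i x ≤ P.f i x

theorem ColdStart.admissible [Nonempty V] {P : Problem V m} {st : State V E m}
    (h : ColdStart P st) : Admissible P st where
  s_pos i := by simp [h.s_one]
  s_nonneg α := by
    rcases α with i | e
    · simp [sAll, h.s_one]
    · simp [sAll, h.sig, h.rho]
  s_sum := by simp [Fintype.sum_sum_type, sAll, h.s_one, h.sig, h.rho]
  y_zero α hα := by
    rcases α with i | e
    · simp [sAll, h.s_one] at hα
    · simp [yAll, h.sig, h.rho]
  y_sum := by
    obtain ⟨y0, hy, hst⟩ := h.start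
    have hc : (Fintype.card V : ℝ) ≠ 0 := by exact_mod_cast Fintype.card_ne_zero
    rw [← hy, smul_inv_smul₀ hc, ← Finset.sum_sub_distrib]
    simp only [Fintype.sum_sum_type, yAll, h.sig, h.rho, sub_zero, Finset.sum_const_zero, add_zero]
    refine Finset.sum_congr rfl fun i _ => ?_
    rw [hst i]
    split_ifs with hi
    · simp [h.z_zero i hi]
    · rfl
  affine := h.affine
  minorant := h.minorant

/-- The number of out-neighbours, plus one. -/
def outDeg1 (E : Finset (V × V)) (i : V) : ℝ := ((E.filter (fun e => e.1 = i)).card : ℝ) + 1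

/-- Operation A: node `i` sends data to all its out-neighbours. -/
def opA (i : V) (st : State V E m) : State V E m :=
  { st with
    y := Function.update st.y i ((outDeg1 E i)⁻¹ • st.y i)
    s := Function.update st.s i (st.s i / outDeg1 E i)
    sigY := Function.update st.sigY i (st.sigY i + (outDeg1 E i)⁻¹ • st.y i)
    sigS := Function.update st.sigS i (st.sigS i + st.s i / outDeg1 E i) }

/-- Operation B: the head of the edge `e` receives the data in transit along `e`. -/
def opB (e : {e : V × V // e ∈ E}) (st : State V E m) : State V E m :=
  { st with
    y := Function.update st.y e.1.2 (st.y e.1.2 + st.sigY e.1.1 - st.rhoY e)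
    s := Function.update st.s e.1.2 (st.s e.1.2 + st.sigS e.1.1 - st.rhoS e)
    rhoY := Function.update st.rhoY e (st.sigY e.1.1)
    rhoS := Function.update st.rhoS e (st.sigS e.1.1) }

/-- The proximal centre used by operation C at node `j`. -/
def xtemp (st : State V E m) (j : V) : X m := (st.s j)⁻¹ • (st.y j + st.z j)

/-- Operation C at a node treated by its proximal map. -/
def OpCProx (P : Problem V m) (j : V) (st st' : State V E m) : Prop :=
  ∃ x : X m,
    IsMinOn (fun w => st.s j / 2 * ‖st.xtemp j - w‖ ^ 2 + P.f j w) Set.univ x ∧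
    st' = { st with
      y := Function.update st.y j (st.s j • x)
      z := Function.update st.z j (st.s j • (st.xtemp j - x)) }

/-- The linearization of `f j` at the current primal value of node `j`, with slope `v`. -/
def linz (P : Problem V m) (j : V) (st : State V E m) (v w : X m) : ℝ :=
  inner ℝ v (w - st.x (Sum.inl j)) + P.f j (st.x (Sum.inl j))

/-- Operation C at a node treated by affine minorants; `v` is a subgradient of `f j` at the
current primal value. -/
def OpCSub (P : Problem V m) (j : V) (st st' : State V E m) : Prop :=
  ∃ v x : X m,
    (∀ w, linz P j st v w ≤ P.f j w) ∧
    IsMinOn (fun w => max (st.fa j w) (linz P j st v w) + st.s j / 2 * ‖w - st.xtemp j‖ ^ 2)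
      Set.univ x ∧
    st' = { st with
      y := Function.update st.y j (st.s j • x)
      z := Function.update st.z j (st.s j • (st.xtemp j - x))
      fa := Function.update st.fa j (fun w =>
        inner ℝ (st.s j • (st.xtemp j - x)) (w - x) + max (st.fa j x) (linz P j st v x)) }

end State

/-- The operations A (on a node), B (on an edge) and C (on a node). -/
inductive Op (V : Type*) (E : Finset (V × V)) where
  | A (i : V) : Op V E
  | B (e : {e : V × V // e ∈ E}) : Op V E
  | C (j : V) : Op V E

/-- `st'` results from `st` by the given operation. -/
def Op.Step (P : Problem V m) (st st' : State V E m) : Op V E → Prop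
  | Op.A i => st' = st.opA i
  | Op.B e => st' = st.opB e
  | Op.C j => (j ∈ P.V₁ ∧ State.OpCProx P j st st') ∨ (j ∉ P.V₁ ∧ State.OpCSub P j st st')

/-- `st'` results from `st` by performing the listed operations in order. -/
def Steps (P : Problem V m) : List (Op V E) → State V E m → State V E m → Prop
  | [], st, st' => st' = st
  | o :: l, st, st' => ∃ mid, o.Step P st mid ∧ Steps P l mid st'

/-- A run of the algorithm from an admissible state: `ops k` lists, in order, the operations
performed to pass from the iterate `k` to the iterate `k + 1`, each at most once. -/
structure IsRun (P : Problem V m) (st : ℕ → State V E m) (ops : ℕ → List (Op V E)) : Prop where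
  init : (st 0).Admissible P
  nodup : ∀ k, (ops k).Nodup
  step : ∀ k, Steps P (ops k) (st k) (st (k + 1))

/-- Positive weights stay between `smin` and `smax`. -/
def WeightsBounded (smin smax : ℝ) (st : ℕ → State V E m) : Prop :=
  ∀ k α, 0 < (st k).sAll α → smin ≤ (st k).sAll α ∧ (st k).sAll α ≤ smax

/-- The `K` iterations that start at the iterate `k₀`: the first one consists of operation C on
all nodes, and for every edge `(i,j)` one of the others performs operation A on `i` followed by
operation B on `(i,j)`. -/
def IsWindow (K : ℕ) (ops : ℕ → List (Op V E)) (k₀ : ℕ) : Prop :=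
  (∀ o, o ∈ ops k₀ ↔ ∃ i, o = Op.C i) ∧
  ∀ e : {e : V × V // e ∈ E}, ∃ k, 1 ≤ k ∧ k + 1 ≤ K ∧
    List.Sublist [Op.A e.1.1, Op.B e] (ops (k₀ + k))

end Graph

end

end DistDyk

set_option linter.unusedSectionVars false

/-! The duality gap of a state splits exactly. For every point w, the majorized dual value plus the
reduced primal objective at w equals the sum of the Fenchel gaps f_i(w) + g_i^*(z_i) - ⟨z_i, w⟩,
where g_i ≤ f_i is the current model, plus the sum of s_α/2 ‖x_α - w‖² (`dualVal_add_reduced`). All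
these terms are nonnegative. At the minimizer this is the distance bound, and strong duality
(`dualOpt_eq`) makes the optimal dual value minus the reduced minimum; the weights enter only
through their sum |V|.

Every operation lowers the dual value by at least a fixed multiple of the squared displacements it
causes (`Op.Step.stepBound`). A and B merge data, and merging loses energy ‖y‖²/(2s) in proportion
to the squared distance of the merged values; C is a proximal step. The factor is uniform because
positive weights stay bounded below even inside an iteration.

In a window, let D₁ be the decrease in the first iteration and D₂ that in the others. Operation C on
all nodes leaves each Fenchel gap, taken at the node's own value, of order D₁
(`fenchelGap_le_of_forall_prox`). Afterwards data are sent and received along every edge in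
boundedly many operations, so the values on an edge and at its two ends differ by O(√D₂)
(`norm_node_sub_le`, `norm_edge_sub_le`), and strong connectivity extends this to all values.
Smoothness moves the Fenchel gaps to one common point at quadratic cost
(`gap_le_of_affine_minorant`). The splitting at that point bounds the gap by G (D₁ + D₂), that is,
gap(end) ≤ G (gap(start) - gap(end)), which is contraction by G/(1+G). -/

namespace DistDyk

/-! ### Convex analysis in a Hilbert space -/

section Hilbert

variable {H : Type*} [NormedAddCommGroup H] [InnerProductSpace ℝ H]

/-- The energy `‖y‖² / (2 s)` of the data `y = s x` with weight `s`. -/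
noncomputable def energy (s : ℝ) (y : H) : ℝ := s / 2 * ‖s⁻¹ • y‖ ^ 2

theorem energy_zero_right (s : ℝ) : energy s (0 : H) = 0 := by simp [energy]

theorem energy_smul {s : ℝ} (hs : s ≠ 0) (a : H) : energy s (s • a) = s / 2 * ‖a‖ ^ 2 := by
  simp [energy, inv_smul_smul₀ hs]

theorem energy_eq_div (s : ℝ) (y : H) : energy s y = ‖y‖ ^ 2 / (2 * s) := by
  rcases eq_or_ne s 0 with rfl | hs
  · simp [energy]
  · rw [energy, norm_smul, mul_pow, Real.norm_eq_abs, sq_abs]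
    field_simp

/-- The variance identity for two weighted points: the energy lost in the merge is their weighted
variance. -/
theorem energy_merge {s t : ℝ} (hs : 0 < s) (ht : 0 < t) (a b : H) :
    energy (s + t) (s • a + t • b) + s * t / (2 * (s + t)) * ‖a - b‖ ^ 2 =
      s / 2 * ‖a‖ ^ 2 + t / 2 * ‖b‖ ^ 2 := by
  have hst : s + t ≠ 0 := by positivity
  rw [energy_eq_div, norm_add_sq_real, norm_sub_sq_real, norm_smul, norm_smul,
    real_inner_smul_left, real_inner_smul_right, mul_pow, mul_pow, Real.norm_eq_abs,
    Real.norm_eq_abs, sq_abs, sq_abs]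
  field_simp
  ring

/-- The quotient increases in both weights and equals `μ / 4` at `s = t = μ`. -/
theorem quarter_le_mul_div_add {μ s t : ℝ} (hμ : 0 < μ) (hs : μ ≤ s) (ht : μ ≤ t) :
    μ / 4 ≤ s * t / (2 * (s + t)) := by
  have hs0 := hμ.trans_le hs
  have ht0 := hμ.trans_le ht
  rw [div_le_div_iff₀ (by norm_num) (by positivity)]
  nlinarith [mul_le_mul_of_nonneg_right hs ht0.le, mul_le_mul_of_nonneg_left ht hs0.le]

/-- Merging data loses at least a multiple of the squared distance of the primal values. -/
theorem energy_merge_le {μ s t : ℝ} (hμ : 0 < μ) (hs : μ ≤ s) (ht : μ ≤ t) (y u : H) :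
    energy (s + t) (y + u) + μ / 4 * ‖s⁻¹ • y - t⁻¹ • u‖ ^ 2 ≤ energy s y + energy t u := by
  have hs0 := hμ.trans_le hs
  have ht0 := hμ.trans_le ht
  have h := energy_merge hs0 ht0 (s⁻¹ • y) (t⁻¹ • u)
  rw [smul_inv_smul₀ hs0.ne', smul_inv_smul₀ ht0.ne'] at h
  have := mul_le_mul_of_nonneg_right (quarter_le_mul_div_add hμ hs ht)
    (sq_nonneg ‖s⁻¹ • y - t⁻¹ • u‖)
  simp only [energy] at h ⊢
  linarith

/-- The merged value is a convex combination of the two values, so it lies on the segment between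
them. -/
theorem norm_merge_sub_left_le {s t : ℝ} (hs : 0 < s) (ht : 0 < t) (y u : H) :
    ‖(s + t)⁻¹ • (y + u) - s⁻¹ • y‖ ≤ ‖s⁻¹ • y - t⁻¹ • u‖ := by
  have hst : s + t ≠ 0 := by positivity
  have : (s + t)⁻¹ • (y + u) - s⁻¹ • y = (-(t / (s + t))) • (s⁻¹ • y - t⁻¹ • u) := by
    match_scalars <;> field_simp
    ring
  rw [this, norm_smul, norm_neg, Real.norm_eq_abs, abs_of_pos (by positivity)]
  refine mul_le_of_le_one_left (norm_nonneg _) ?_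
  rw [div_le_one (by positivity)]
  linarith

/-- A vanishing or a substantial weight `t` is merged into a substantial weight `s`. -/
theorem energy_merge_left_le {μ s t : ℝ} (hμ : 0 < μ) (hs : μ ≤ s) {y u : H}
    (ht : (t = 0 ∧ u = 0) ∨ μ ≤ t) :
    energy (s + t) (y + u) + μ / 4 * ‖(s + t)⁻¹ • (y + u) - s⁻¹ • y‖ ^ 2 ≤
      energy s y + energy t u := by
  rcases ht with ⟨rfl, rfl⟩ | ht
  · simp [energy_zero_right]
  · refine le_trans ?_ (energy_merge_le hμ hs ht y u)
    have := norm_merge_sub_left_le (hμ.trans_le hs) (hμ.trans_le ht) y u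
    gcongr

/-- The optimality condition of a proximal step. -/
theorem subgradient_of_isMinOn {M : H → ℝ} (hM : ConvexOn ℝ Set.univ M) {s : ℝ} {c x : H}
    (hmin : IsMinOn (fun w => M w + s / 2 * ‖w - c‖ ^ 2) Set.univ x) (w : H) :
    M x + inner ℝ (s • (c - x)) (w - x) ≤ M w := by
  by_contra! hlt
  set A := M w - M x - inner ℝ (s • (c - x)) (w - x) with hA
  have hA0 : A < 0 := by linarith
  set B := s / 2 * ‖w - x‖ ^ 2 with hB
  -- Minimality of `x` against `x + t • (w - x)` and convexity of `M` give this after division by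
  -- `t`.
  have key : ∀ t : ℝ, 0 < t → t ≤ 1 → 0 ≤ A + t * B := by
    intro t ht ht1
    have h1 := hmin (Set.mem_univ (x + t • (w - x)))
    have h2 := hM.2 (Set.mem_univ x) (Set.mem_univ w) (sub_nonneg.2 ht1) ht.le (by ring)
    have h3 : (1 - t) • x + t • w = x + t • (w - x) := by module
    rw [h3] at h2
    simp only [smul_eq_mul, Set.mem_ofPred_eq] at h1 h2
    have h4 : x + t • (w - x) - c = t • (w - x) - (c - x) := by abel
    have h5 : ‖x - c‖ ^ 2 = ‖c - x‖ ^ 2 := by rw [norm_sub_rev]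
    rw [h4, h5, norm_sub_sq_real (t • (w - x)), norm_smul, real_inner_smul_left, mul_pow, Real.norm_eq_abs,
      sq_abs] at h1
    rw [real_inner_smul_left, real_inner_comm] at hA
    have h6 : 0 ≤ t * (A + t * B) := by rw [hA, hB]; nlinarith
    exact nonneg_of_mul_nonneg_right h6 ht
  -- The test value t = -A / (2 (|B| - A)) is so small that t B ≤ -A/2, whence A + t B ≤ A/2 < 0.
  have hd : 0 < 2 * (|B| - A) := by have := abs_nonneg B; linarith
  have ht1 : -A / (2 * (|B| - A)) ≤ 1 := by
    rw [div_le_one hd]; have := abs_nonneg B; linarith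
  have h := key (-A / (2 * (|B| - A))) (div_pos (by linarith) hd) ht1
  have h7 : -A / (2 * (|B| - A)) * B ≤ -A / 2 := by
    rw [div_mul_eq_mul_div, div_le_div_iff₀ hd (by norm_num)]
    nlinarith [le_abs_self B]
  linarith

section Complete

variable [CompleteSpace H]

/-- On the line through `u` and `w`, the derivative at 0 is at most the slope over [0, 1]. -/
theorem _root_.ConvexOn.add_inner_gradient_le {f : H → ℝ} (hf : ConvexOn ℝ Set.univ f)
    (hd : Differentiable ℝ f) (u w : H) : f u + inner ℝ (gradient f u) (w - u) ≤ f w := by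
  have hline : ConvexOn ℝ Set.univ (fun t : ℝ => f (AffineMap.lineMap u w t)) := by
    have := hf.comp_affineMap (AffineMap.lineMap (k := ℝ) u w)
    rwa [Set.preimage_univ] at this
  have hder : HasDerivAt (fun t : ℝ => f (AffineMap.lineMap u w t))
      (inner ℝ (gradient f u) (w - u)) 0 := by
    have h1 : HasFDerivAt f (fderiv ℝ f u) (AffineMap.lineMap u w (0 : ℝ)) := by
      simpa using (hd u).hasFDerivAt
    have h2 := h1.comp_hasDerivAt (0 : ℝ)
      (AffineMap.hasDerivAt_lineMap (𝕜 := ℝ) (a := u) (b := w) (x := (0 : ℝ)))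
    rw [inner_gradient_left]
    exact h2
  have h := hline.le_slope_of_hasDerivAt (Set.mem_univ (0 : ℝ)) (Set.mem_univ (1 : ℝ)) one_pos hder
  rw [slope_def_field, AffineMap.lineMap_apply_one, AffineMap.lineMap_apply_zero] at h
  linarith

/-- The gradient inequality based at `w` has the slope at `w`, which differs from the slope at `u`
by at most `L * ‖w - u‖ ^ 2`. No integration is needed, at the price of `L` instead of L/2. -/
theorem _root_.ConvexOn.le_add_inner_gradient {f : H → ℝ} (hf : ConvexOn ℝ Set.univ f)
    (hd : Differentiable ℝ f) {L : ℝ}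
    (hL : ∀ x y, ‖gradient f x - gradient f y‖ ≤ L * ‖x - y‖) (u w : H) :
    f w ≤ f u + inner ℝ (gradient f u) (w - u) + L * ‖w - u‖ ^ 2 := by
  have h := hf.add_inner_gradient_le hd w u
  have h1 : inner ℝ (gradient f w) (w - u) = inner ℝ (gradient f u) (w - u) +
      inner ℝ (gradient f w - gradient f u) (w - u) := by rw [inner_sub_left]; ring
  have h2 : inner ℝ (gradient f w) (u - w) = - inner ℝ (gradient f w) (w - u) := by
    rw [← inner_neg_right, neg_sub]
  have h3 := real_inner_le_norm (gradient f w - gradient f u) (w - u)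
  have h4 := mul_le_mul_of_nonneg_right (hL w u) (norm_nonneg (w - u))
  nlinarith

/-- The gap between a smooth convex function and an affine minorant grows at most
quadratically. -/
theorem gap_le_of_affine_minorant {f : H → ℝ} (hf : ConvexOn ℝ Set.univ f)
    (hd : Differentiable ℝ f) {L : ℝ}
    (hL : ∀ x y, ‖gradient f x - gradient f y‖ ≤ L * ‖x - y‖) {z : H} {b : ℝ}
    (hmin : ∀ w, inner ℝ z w + b ≤ f w) (u w : H) :
    f w - (inner ℝ z w + b) ≤ 2 * (f u - (inner ℝ z u + b)) + 2 * L * ‖w - u‖ ^ 2 := by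
  have h1 := hf.le_add_inner_gradient hd hL u w
  -- The gap is nonnegative at the reflection of `w` in `u`; this bounds its slope towards `w` by
  -- its value at `u` plus a quadratic term.
  have h2 := hf.le_add_inner_gradient hd hL u (u - (w - u))
  have h3 := hmin (u - (w - u))
  have h4 : u - (w - u) - u = - (w - u) := by abel
  rw [h4, inner_neg_right, norm_neg] at h2
  have h5 : inner ℝ z w = inner ℝ z u + inner ℝ z (w - u) := by rw [inner_sub_right]; ring
  rw [inner_sub_right] at h3
  linarith

end Complete

/-! ### Conjugates -/

theorem le_conj (g : H → ℝ) (z x : H) : ((inner ℝ z x - g x : ℝ) : EReal) ≤ conj g z :=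
  le_iSup (fun x : H => ((inner ℝ z x - g x : ℝ) : EReal)) x

theorem conj_ne_bot (g : H → ℝ) (z : H) : conj g z ≠ ⊥ :=
  ((EReal.bot_lt_coe _).trans_le (le_conj g z 0)).ne'

/-- The equality case of the Fenchel–Young inequality. -/
theorem conj_eq_of_subgradient {g : H → ℝ} {z x : H} (h : ∀ w, g x + inner ℝ z (w - x) ≤ g w) :
    conj g z = ((inner ℝ z x - g x : ℝ) : EReal) := by
  refine le_antisymm (iSup_le fun w => ?_) (le_conj g z x)
  have := h w
  rw [inner_sub_right] at this
  exact EReal.coe_le_coe_iff.2 (by linarith)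

theorem conj_affine {g : H → ℝ} {z : H} {b : ℝ} (h : ∀ w, g w = inner ℝ z w + b) :
    conj g z = ((-b : ℝ) : EReal) := by
  rw [conj_eq_of_subgradient (x := 0)]
  · simp [h]
  · intro w; simp [h]; linarith

end Hilbert

/-! ### Sums of extended reals -/

theorem coe_sum_ereal {ι : Type*} (s : Finset ι) (f : ι → ℝ) :
    ((∑ i ∈ s, f i : ℝ) : EReal) = ∑ i ∈ s, (f i : EReal) := by
  classical
  induction s using Finset.induction_on with
  | empty => simp
  | insert a s ha ih => rw [Finset.sum_insert ha, Finset.sum_insert ha, EReal.coe_add, ih]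

theorem ereal_sum_ne_bot {ι : Type*} (s : Finset ι) (f : ι → EReal) (h : ∀ i ∈ s, f i ≠ ⊥) :
    ∑ i ∈ s, f i ≠ ⊥ := by
  classical
  induction s using Finset.induction_on with
  | empty => simp
  | insert a s ha ih =>
    rw [Finset.sum_insert ha, ne_eq, EReal.add_eq_bot_iff, not_or]
    exact ⟨h a (Finset.mem_insert_self a s), ih fun i hi => h i (Finset.mem_insert_of_mem hi)⟩

theorem ereal_sum_eq_top {ι : Type*} [DecidableEq ι] {s : Finset ι} {f : ι → EReal}
    (h : ∀ i ∈ s, f i ≠ ⊥) {a : ι} (ha : a ∈ s) (hf : f a = ⊤) : ∑ i ∈ s, f i = ⊤ := by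
  rw [← Finset.add_sum_erase s f ha, hf]
  exact EReal.top_add_of_ne_bot
    (ereal_sum_ne_bot _ _ fun i hi => h i (Finset.mem_of_mem_erase hi))

section Graph

variable {V : Type*} [Fintype V] [DecidableEq V] {E : Finset (V × V)} {m : ℕ}

/-! ### The consensus subspace and dual variables -/

/-- The vector of the product space with all components equal to `w`. -/
def constVec (V : Type*) (E : Finset (V × V)) {m : ℕ} (w : X m) : PVec V E m :=
  WithLp.toLp 2 fun _ => w

/-- The vector of the product space with the only nonzero component `w` at the node `i`. -/
def nodeVec (E : Finset (V × V)) (i : V) (w : X m) : PVec V E m :=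
  WithLp.toLp 2 (Pi.single (Sum.inl i) w)

theorem inner_constVec (u : PVec V E m) (w : X m) :
    inner ℝ u (constVec V E w) = inner ℝ (∑ α, u α) w := by
  rw [PiLp.inner_apply, sum_inner]
  rfl

theorem constVec_mem_hyper (β : Sym2 (Idx V E)) (w : X m) : constVec V E w ∈ hyper m β :=
  fun _ _ _ _ => rfl

/-- The pairs connect all of V ∪ E: strong connectivity links the nodes, and each edge is paired
with its tail. Hence the intersection of the H_β consists of the constant vectors. -/
theorem eq_of_mem_hyper (hE : StronglyConnected E) {u : PVec V E m}
    (hu : ∀ β ∈ pairs E, u ∈ hyper m β) (α α' : Idx V E) : u α = u α' := by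
  have hedge (e : {e : V × V // e ∈ E}) : u (Sum.inl e.1.1) = u (Sum.inr e) :=
    hu s(Sum.inl e.1.1, Sum.inr e)
      (Finset.mem_union_left _ (Finset.mem_image_of_mem _ (Finset.mem_univ e)))
      _ (Sym2.mem_mk_left _ _) _ (Sym2.mem_mk_right _ _)
  have hnode (e : {e : V × V // e ∈ E}) : u (Sum.inl e.1.1) = u (Sum.inl e.1.2) :=
    hu s(Sum.inl e.1.1, Sum.inl e.1.2)
      (Finset.mem_union_right _ (Finset.mem_image_of_mem
        (fun e : {e : V × V // e ∈ E} => s((Sum.inl e.1.1 : Idx V E), (Sum.inl e.1.2 : Idx V E)))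
        (Finset.mem_univ e)))
      _ (Sym2.mem_mk_left _ _) _ (Sym2.mem_mk_right _ _)
  have hnodes (i j : V) : u (Sum.inl i) = u (Sum.inl j) := by
    induction hE i j with
    | refl => rfl
    | tail _ h ih => exact ih.trans (hnode ⟨_, h⟩)
  have hall (α : Idx V E) (i : V) : u α = u (Sum.inl i) := by
    rcases α with j | e
    · exact hnodes j i
    · exact (hedge e).symm.trans (hnodes _ i)
  rcases α' with i | e
  · exact hall α i
  · exact (hall α e.1.1).trans (hedge e)

/-- In finite dimension the sum of the H_β^⊥ is the orthogonal complement of the intersection of the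
H_β, and being orthogonal to all constant vectors means having component sum zero. -/
theorem exists_pair_sum_eq (hE : StronglyConnected E) {u : PVec V E m} (hu : ∑ α, u α = 0) :
    ∃ p : {β : Sym2 (Idx V E) // β ∈ pairs E} → PVec V E m,
      (∀ β, p β ∈ (hyper m β.1)ᗮ) ∧ ∑ β, p β = u := by
  classical
  set S := ⨆ β : {β : Sym2 (Idx V E) // β ∈ pairs E}, (hyper m β.1)ᗮ with hS
  have hmem : u ∈ S := by
    rw [← Submodule.orthogonal_orthogonal S, Submodule.mem_orthogonal]
    intro v hv
    rw [hS, ← Submodule.iInf_orthogonal, Submodule.mem_iInf] at hv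
    simp only [Submodule.orthogonal_orthogonal] at hv
    have hv' := eq_of_mem_hyper hE fun β hβ => hv ⟨β, hβ⟩
    rcases isEmpty_or_nonempty (Idx V E) with h | ⟨⟨α⟩⟩
    · simp [PiLp.inner_apply]
    · have : v = constVec V E (v α) := by
        ext1 α'
        exact hv' α' α
      rw [this, real_inner_comm, inner_constVec, hu, inner_zero_left]
  rw [hS, Submodule.mem_iSup_iff_exists_dfinsupp'] at hmem
  obtain ⟨f, hf⟩ := hmem
  refine ⟨fun β => f β, fun β => (f β).2, ?_⟩
  rw [← hf, DFinsupp.sum_eq_sum_fintype _ fun _ => rfl]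
  rfl

/-- What the node parts leave over has component sum zero and can be spread over the pairs. This
yields both the optimal dual variable and the dual variables of the iterates. -/
theorem exists_dualVar (hE : StronglyConnected E) (zn : V → X m) (t : PVec V E m)
    (h : ∑ α, t α = ∑ i, zn i) :
    ∃ z : DualVar V E m, (∀ i, z.node i = nodeVec E i (zn i)) ∧
      (∀ β, z.pair β ∈ (hyper m β.1)ᗮ) ∧ z.total = t := by
  have hn : ∑ α, (t - ∑ i, nodeVec E i (zn i)) α = 0 := by
    have h1 (i : V) : ∑ α : Idx V E, nodeVec E i (zn i) α = zn i := by
      rw [Finset.sum_eq_single (Sum.inl i)]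
      · simp [nodeVec]
      · intro α _ hα; simp [nodeVec, hα]
      · simp
    simp only [PiLp.sub_apply, Finset.sum_sub_distrib, WithLp.ofLp_sum, Finset.sum_apply]
    rw [Finset.sum_comm, h, Finset.sum_congr rfl fun i _ => h1 i, sub_self]
  obtain ⟨p, hp, hps⟩ := exists_pair_sum_eq hE hn
  refine ⟨⟨fun i => nodeVec E i (zn i), p⟩, fun _ => rfl, hp, ?_⟩
  simp only [DualVar.total]
  rw [hps, add_sub_cancel]

/-! ### The dual objective -/

theorem quad_eq_energy {s : ℝ} {y : X m} (h : s = 0 → y = 0) :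
    quad s y = ((energy s y : ℝ) : EReal) := by
  unfold quad
  split_ifs with h1 h2
  · simp [energy, h1]
  · exact absurd (h h1) h2
  · rfl

theorem inner_sub_le_energy {s : ℝ} (hs : 0 < s) (y w : X m) :
    inner ℝ y w - s / 2 * ‖w‖ ^ 2 ≤ energy s y := by
  have h1 : 0 ≤ s / 2 * ‖s⁻¹ • y - w‖ ^ 2 := by positivity
  rw [norm_sub_sq_real, real_inner_smul_left] at h1
  have h2 : s / 2 * (2 * (s⁻¹ * inner ℝ y w)) = inner ℝ y w := by field_simp
  unfold energy
  linarith

theorem le_quad {s : ℝ} (hs : 0 ≤ s) (y w : X m) :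
    ((inner ℝ y w - s / 2 * ‖w‖ ^ 2 : ℝ) : EReal) ≤ quad s y := by
  by_cases h : s = 0 → y = 0
  · rw [quad_eq_energy h]
    rcases hs.eq_or_lt with rfl | hs
    · simp [h rfl, energy]
    · exact EReal.coe_le_coe_iff.2 (inner_sub_le_energy hs y w)
  · push Not at h
    simp [quad, h]

theorem le_indic {H : Type*} [NormedAddCommGroup H] [InnerProductSpace ℝ H] {S : Submodule ℝ H}
    {w : H} (hw : w ∈ S) (z : H) : ((inner ℝ z w : ℝ) : EReal) ≤ indic Sᗮ z := by
  unfold indic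
  split_ifs with h
  · rw [Submodule.inner_left_of_mem_orthogonal hw h]; rfl
  · exact le_top

/-- Only the component at `i` is paired with `z`, and constant vectors realize each of its values.
-/
theorem conj_node {g : X m → ℝ} {i : V} {z : PVec V E m}
    (hz : ∀ α, α ≠ Sum.inl i → z α = 0) :
    conj (fun x : PVec V E m => g (x (Sum.inl i))) z = conj g (z (Sum.inl i)) := by
  have h (x : PVec V E m) : inner ℝ z x = inner ℝ (z (Sum.inl i)) (x (Sum.inl i)) := by
    rw [PiLp.inner_apply, Finset.sum_eq_single (Sum.inl i)]
    · intro α _ hα; simp [hz α hα]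
    · simp
  refine le_antisymm (iSup_le fun x => ?_) (iSup_le fun x => ?_)
  · rw [h]; exact le_conj g _ _
  · have := le_conj (fun x : PVec V E m => g (x (Sum.inl i))) z (constVec V E x)
    rw [h] at this
    exact this

theorem dualObj_eq {g : V → X m → ℝ} {c : X m} {s : Idx V E → ℝ} {z : DualVar V E m}
    (hz : ∀ i α, α ≠ Sum.inl i → z.node i α = 0) (hp : ∀ β, z.pair β ∈ (hyper m β.1)ᗮ) :
    dualObj g c s z = ∑ i, conj (g i) (z.node i (Sum.inl i)) +
      ∑ α, quad (s α) (s α • c - z.total α) := by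
  unfold dualObj
  have h1 (i : V) := conj_node (g := g i) (hz i)
  have h2 (β) : indic (hyper m β.1)ᗮ (z.pair β) = 0 := if_pos (hp β)
  simp only [h1, h2, Finset.sum_const_zero, add_zero]

/-! ### The primal problem -/

/-- The primal objective up to a constant. -/
noncomputable def Problem.reduced (P : Problem V m) (w : X m) : ℝ :=
  ∑ i, P.f i w + Fintype.card V / 2 * ‖w‖ ^ 2 - Fintype.card V * inner ℝ P.mbar w

theorem Problem.objective_eq [Nonempty V] (P : Problem V m) (w : X m) :
    P.objective w = P.reduced w + 1 / 2 * ∑ i, ‖P.xbar i‖ ^ 2 := by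
  have hc : (Fintype.card V : ℝ) ≠ 0 := by exact_mod_cast Fintype.card_ne_zero
  have h1 : Fintype.card V * inner ℝ P.mbar w = ∑ i, inner ℝ (P.xbar i) w := by
    rw [Problem.mbar, real_inner_smul_left, mul_inv_cancel_left₀ hc, sum_inner]
  rw [Problem.reduced, h1, Problem.objective]
  simp only [norm_sub_sq_real, mul_add, mul_sub, Finset.sum_add_distrib, Finset.sum_sub_distrib,
    Finset.sum_const, Finset.card_univ, nsmul_eq_mul, ← Finset.mul_sum, real_inner_comm w]
  ring

/-- In the direction t (v - g) with small t > 0, the quadratic term absorbs at most half of the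
linear one, which forces v - g = 0. -/
theorem eq_of_inner_le_add_sq {H : Type*} [NormedAddCommGroup H] [InnerProductSpace ℝ H]
    {v g : H} {B : ℝ} (h : ∀ d, inner ℝ v d ≤ inner ℝ g d + B * ‖d‖ ^ 2) : v = g := by
  set t : ℝ := 1 / (2 * (|B| + 1)) with ht
  have hB := abs_nonneg B
  have ht0 : 0 < t := by positivity
  have h1 := h (t • (v - g))
  have h2 : inner ℝ v (t • (v - g)) - inner ℝ g (t • (v - g)) = t * ‖v - g‖ ^ 2 := by
    rw [← inner_sub_left, real_inner_smul_right, real_inner_self_eq_norm_sq]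
  rw [norm_smul, mul_pow, Real.norm_eq_abs, sq_abs] at h1
  have h3 : t * |B| ≤ 1 / 2 := by
    rw [ht, div_mul_eq_mul_div, div_le_div_iff₀ (by positivity) (by norm_num)]
    linarith
  have h4 : B * (t ^ 2 * ‖v - g‖ ^ 2) ≤ t * (1 / 2) * ‖v - g‖ ^ 2 := by
    have : t * B ≤ 1 / 2 := (mul_le_mul_of_nonneg_left (le_abs_self B) ht0.le).trans h3
    have := mul_le_mul_of_nonneg_right this (mul_nonneg ht0.le (sq_nonneg ‖v - g‖))
    linarith
  have h5 : ‖v - g‖ ^ 2 ≤ 0 := by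
    by_contra! h6
    have := mul_pos ht0 h6
    linarith
  rw [← sub_eq_zero, ← norm_eq_zero]
  exact pow_eq_zero_iff (two_ne_zero) |>.1 (le_antisymm h5 (sq_nonneg _))

namespace Problem.Smooth

variable {P : Problem V m} {σ : ℝ}

theorem convexOn_sum (h : P.Smooth σ) : ConvexOn ℝ Set.univ fun w => ∑ i, P.f i w := by
  refine ⟨convex_univ, fun x _ y _ a b ha hb hab => ?_⟩
  simp only [smul_eq_mul, Finset.mul_sum, ← Finset.sum_add_distrib]
  exact Finset.sum_le_sum fun i _ => (h i).1.2 (Set.mem_univ x) (Set.mem_univ y) ha hb hab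

/-- Linearizing the `P.f i` at the origin bounds the objective below by a quadratic that tends to
infinity, so it is continuous and coercive. -/
theorem exists_reduced_le [Nonempty V] (h : P.Smooth σ) : ∃ x, ∀ w, P.reduced x ≤ P.reduced w := by
  have hcont : Continuous P.reduced := by
    have := fun i => (h i).2.1.continuous
    unfold Problem.reduced
    fun_prop
  refine hcont.exists_forall_le ?_
  set g := ∑ i, gradient (P.f i) 0 - (Fintype.card V : ℝ) • P.mbar with hg
  have hN : (0 : ℝ) < Fintype.card V / 2 := by
    have : 0 < Fintype.card V := Fintype.card_pos
    positivity
  have hlow (w : X m) : ‖w‖ * (Fintype.card V / 2 * ‖w‖ - ‖g‖) + ∑ i, P.f i 0 ≤ P.reduced w := by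
    have h1 : ∑ i, (P.f i 0 + inner ℝ (gradient (P.f i) 0) (w - 0)) ≤ ∑ i, P.f i w :=
      Finset.sum_le_sum fun i _ => (h i).1.add_inner_gradient_le (h i).2.1 0 w
    rw [Finset.sum_add_distrib, sub_zero, ← sum_inner] at h1
    have h2 : inner ℝ g w =
        inner ℝ (∑ i, gradient (P.f i) 0) w - Fintype.card V * inner ℝ P.mbar w := by
      rw [hg, inner_sub_left, real_inner_smul_left]
    have h3 := neg_le_of_abs_le (abs_real_inner_le_norm g w)
    unfold Problem.reduced
    nlinarith
  refine Filter.tendsto_atTop_mono hlow (Filter.tendsto_atTop_add_const_right _ _ ?_)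
  have hn := tendsto_norm_cocompact_atTop (E := X m)
  exact hn.atTop_mul_atTop₀
    (Filter.tendsto_atTop_add_const_right _ (-‖g‖) (hn.const_mul_atTop hN))

/-- Completing the square turns the primal problem into a proximal step with centre `P.mbar` and
weight |V|. -/
theorem reduced_eq (P : Problem V m) (w : X m) :
    (∑ i, P.f i w) + Fintype.card V / 2 * ‖w - P.mbar‖ ^ 2 =
      P.reduced w + Fintype.card V / 2 * ‖P.mbar‖ ^ 2 := by
  rw [Problem.reduced, norm_sub_sq_real, real_inner_comm]
  ring

theorem subgradient_of_reduced_le (h : P.Smooth σ) {x : X m} (hx : ∀ w, P.reduced x ≤ P.reduced w)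
    (w : X m) : ∑ i, P.f i x + inner ℝ ((Fintype.card V : ℝ) • (P.mbar - x)) (w - x) ≤
      ∑ i, P.f i w := by
  refine subgradient_of_isMinOn h.convexOn_sum (fun w _ => ?_) w
  simp only [Set.mem_ofPred_eq, reduced_eq]
  linarith [hx w]

theorem reduced_add_sq_le (h : P.Smooth σ) {x : X m} (hx : ∀ w, P.reduced x ≤ P.reduced w)
    (w : X m) : P.reduced x + Fintype.card V / 2 * ‖w - x‖ ^ 2 ≤ P.reduced w := by
  have h1 := h.subgradient_of_reduced_le hx w
  have h2 := norm_sub_sq_real w x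
  have h3 := real_inner_self_eq_norm_sq x
  rw [real_inner_smul_left, inner_sub_left, inner_sub_right, inner_sub_right,
    real_inner_comm w x, h3] at h1
  unfold Problem.reduced
  rw [h2]
  linarith

/-- The right side is a subgradient of the sum at the minimizer, and a smooth function has no
subgradient but its gradient. -/
theorem sum_gradient_eq (h : P.Smooth σ) {x : X m} (hx : ∀ w, P.reduced x ≤ P.reduced w) :
    ∑ i, gradient (P.f i) x = (Fintype.card V : ℝ) • (P.mbar - x) := by
  refine (eq_of_inner_le_add_sq (B := Fintype.card V * (1 / σ)) fun d => ?_).symm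
  have h1 := h.subgradient_of_reduced_le hx (x + d)
  have h2 : ∑ i, P.f i (x + d) ≤
      ∑ i, (P.f i x + inner ℝ (gradient (P.f i) x) (x + d - x) + 1 / σ * ‖x + d - x‖ ^ 2) :=
    Finset.sum_le_sum fun i _ => (h i).1.le_add_inner_gradient (h i).2.1 (h i).2.2 x (x + d)
  rw [add_sub_cancel_left] at h1 h2
  rw [Finset.sum_add_distrib, Finset.sum_add_distrib, ← sum_inner, Finset.sum_const,
    Finset.card_univ, nsmul_eq_mul] at h2
  linarith

theorem conj_gradient (h : P.Smooth σ) (i : V) (x : X m) :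
    conj (P.f i) (gradient (P.f i) x) =
      ((inner ℝ (gradient (P.f i) x) x - P.f i x : ℝ) : EReal) :=
  conj_eq_of_subgradient fun w => (h i).1.add_inner_gradient_le (h i).2.1 x w

end Problem.Smooth

/-- Weak duality. -/
theorem neg_reduced_le_dualObj (P : Problem V m) {s : Idx V E → ℝ} (hs : ∀ α, 0 ≤ s α)
    (hsum : ∑ α, s α = Fintype.card V) (z : DualVar V E m) (w : X m) :
    ((-P.reduced w : ℝ) : EReal) ≤ dualObj P.f P.mbar s z := by
  -- Each dual term dominates its Fenchel–Young pairing with the constant vector of value `w`; in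
  -- the sum the pairings of `z` cancel.
  have h1 : ((∑ i, (inner ℝ (z.node i) (constVec V E w) - P.f i w) : ℝ) : EReal) ≤
      ∑ i, conj (fun x : PVec V E m => P.f i (x (Sum.inl i))) (z.node i) := by
    rw [coe_sum_ereal]
    exact Finset.sum_le_sum fun i _ =>
      le_conj (fun x : PVec V E m => P.f i (x (Sum.inl i))) (z.node i) (constVec V E w)
  have h2 : ((∑ β, inner ℝ (z.pair β) (constVec V E w) : ℝ) : EReal) ≤
      ∑ β, indic (hyper m β.1)ᗮ (z.pair β) := by
    rw [coe_sum_ereal]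
    exact Finset.sum_le_sum fun β _ => le_indic (constVec_mem_hyper β.1 w) _
  have h3 : ((∑ α, (inner ℝ (s α • P.mbar - z.total α) w - s α / 2 * ‖w‖ ^ 2) : ℝ) : EReal) ≤
      ∑ α, quad (s α) (s α • P.mbar - z.total α) := by
    rw [coe_sum_ereal]
    exact Finset.sum_le_sum fun α _ => le_quad (hs α) _ _
  refine le_trans (le_of_eq ?_) (add_le_add (add_le_add h1 h2) h3)
  rw [← EReal.coe_add, ← EReal.coe_add, EReal.coe_eq_coe_iff]
  have h4 : ∑ α, inner ℝ (z.total α) w = ∑ i, inner ℝ (z.node i) (constVec V E w) +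
      ∑ β, inner ℝ (z.pair β) (constVec V E w) := by
    rw [← sum_inner, ← inner_constVec, DualVar.total, inner_add_left, sum_inner, sum_inner]
  simp only [inner_sub_left, Finset.sum_sub_distrib, real_inner_smul_left, h4, ← Finset.sum_mul,
    ← Finset.sum_div, hsum, Problem.reduced]
  ring

/-- With node parts ∇f_i(x) and total s_α (mbar - x), every primal value is the minimizer `x` and
all the inequalities of weak duality become equalities. -/
theorem dualOpt_eq [Nonempty V] (hE : StronglyConnected E) {P : Problem V m} {σ : ℝ}
    (h : P.Smooth σ) {s : Idx V E → ℝ} (hs : ∀ α, 0 ≤ s α) (hsum : ∑ α, s α = Fintype.card V)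
    {x : X m} (hx : ∀ w, P.reduced x ≤ P.reduced w) :
    dualOpt P s = ((-P.reduced x : ℝ) : EReal) := by
  refine le_antisymm ?_ (le_iInf fun z => neg_reduced_le_dualObj P hs hsum z x)
  obtain ⟨z, hz, hp, ht⟩ := exists_dualVar hE (fun i => gradient (P.f i) x)
    (WithLp.toLp 2 fun α => s α • (P.mbar - x)) (by
      rw [h.sum_gradient_eq hx, ← hsum, Finset.sum_smul])
  refine (iInf_le _ z).trans (le_of_eq ?_)
  rw [dualObj_eq (fun i α hα => by rw [hz]; simp [nodeVec, hα]) hp]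
  have h1 (i : V) : conj (P.f i) (z.node i (Sum.inl i)) =
      ((inner ℝ (gradient (P.f i) x) x - P.f i x : ℝ) : EReal) := by
    rw [← h.conj_gradient, hz]
    simp [nodeVec]
  have h2 (α : Idx V E) : quad (s α) (s α • P.mbar - z.total α) =
      ((s α / 2 * ‖x‖ ^ 2 : ℝ) : EReal) := by
    have h3 : s α • P.mbar - z.total α = s α • x := by
      rw [ht]
      change s α • P.mbar - s α • (P.mbar - x) = _
      module
    rw [h3, quad_eq_energy (fun h0 => by simp [h0]), EReal.coe_eq_coe_iff]
    rcases eq_or_ne (s α) 0 with h0 | h0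
    · simp [h0, energy]
    · exact energy_smul h0 x
  simp only [h1, h2, ← coe_sum_ereal, ← EReal.coe_add, EReal.coe_eq_coe_iff]
  rw [Finset.sum_sub_distrib, ← sum_inner, h.sum_gradient_eq hx, ← Finset.sum_mul,
    ← Finset.sum_div, hsum, real_inner_smul_left, inner_sub_left, real_inner_self_eq_norm_sq,
    Problem.reduced]
  ring

/-! ### Dual value and Fenchel gaps of a state -/

namespace State

variable {P : Problem V m} {st st' : State V E m}

/-- All conjugates in the majorized dual objective are finite. -/
def FiniteConj (P : Problem V m) (st : State V E m) : Prop :=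
  ∀ i, conj (st.maj P i) (st.z i) ≠ ⊤

/-- The conjugate of the current function of node `i` at the current dual variable. -/
noncomputable def conjVal (P : Problem V m) (st : State V E m) (i : V) : ℝ :=
  (conj (st.maj P i) (st.z i)).toReal

/-- The majorized dual objective as a real number. -/
noncomputable def dualVal (P : Problem V m) (st : State V E m) : ℝ :=
  ∑ i, st.conjVal P i + ∑ α, energy (st.sAll α) (st.yAll α)

/-- The Fenchel gap of node `i` at the point `w`. -/
noncomputable def fenchelGap (P : Problem V m) (st : State V E m) (i : V) (w : X m) : ℝ :=
  st.conjVal P i - inner ℝ (st.z i) w + P.f i w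

/-- All positive weights are at least `μ`. -/
def WeightsGE (μ : ℝ) (st : State V E m) : Prop := ∀ α, st.sAll α = 0 ∨ μ ≤ st.sAll α

theorem WeightsGE.node_le {μ : ℝ} (h : st.WeightsGE μ) (ha : st.Admissible P) (i : V) :
    μ ≤ st.s i :=
  (h (Sum.inl i)).resolve_left (ha.s_pos i).ne'

theorem coe_conjVal {i : V} (h : conj (st.maj P i) (st.z i) ≠ ⊤) :
    ((st.conjVal P i : ℝ) : EReal) = conj (st.maj P i) (st.z i) :=
  EReal.coe_toReal h (conj_ne_bot _ _)

theorem Admissible.maj_le (ha : st.Admissible P) (i : V) (w : X m) : st.maj P i w ≤ P.f i w := by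
  unfold maj
  split_ifs with h
  · exact le_rfl
  · exact ha.minorant i h w

theorem Admissible.inner_sub_conjVal_le (ha : st.Admissible P) {i : V}
    (h : conj (st.maj P i) (st.z i) ≠ ⊤) (w : X m) :
    inner ℝ (st.z i) w + -st.conjVal P i ≤ P.f i w := by
  have h1 := le_conj (st.maj P i) (st.z i) w
  rw [← coe_conjVal h, EReal.coe_le_coe_iff] at h1
  linarith [ha.maj_le i w]

theorem Admissible.fenchelGap_nonneg (ha : st.Admissible P) (h : st.FiniteConj P) (i : V)
    (w : X m) : 0 ≤ st.fenchelGap P i w := by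
  have := ha.inner_sub_conjVal_le (h i) w
  unfold fenchelGap
  linarith

/-- Since the model lies below `P.f i`, the dual variable and the conjugate value define an affine
minorant of `P.f i`. -/
theorem Admissible.fenchelGap_le {σ : ℝ} (hP : P.Smooth σ) (ha : st.Admissible P)
    (h : st.FiniteConj P) (i : V) (u w : X m) :
    st.fenchelGap P i w ≤ 2 * st.fenchelGap P i u + 2 * (1 / σ) * ‖w - u‖ ^ 2 := by
  have := gap_le_of_affine_minorant (hP i).1 (hP i).2.1 (hP i).2.2
    (ha.inner_sub_conjVal_le (h i)) u w
  unfold fenchelGap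
  linarith

/-- The real dual objective plus the primal one is a sum of Fenchel gaps and weighted squared
distances. -/
theorem Admissible.dualVal_add_reduced (ha : st.Admissible P) (w : X m) :
    st.dualVal P + P.reduced w =
      ∑ i, st.fenchelGap P i w + ∑ α, st.sAll α / 2 * ‖st.x α - w‖ ^ 2 := by
  -- Where the weight is zero, both sides vanish because `y_α = 0`.
  have h1 (α : Idx V E) : st.sAll α / 2 * ‖st.x α - w‖ ^ 2 =
      energy (st.sAll α) (st.yAll α) - inner ℝ (st.yAll α) w + st.sAll α / 2 * ‖w‖ ^ 2 := by
    rw [norm_sub_sq_real, energy, x, real_inner_smul_left]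
    rcases eq_or_ne (st.sAll α) 0 with h | h
    · simp [h, ha.y_zero α h]
    · field_simp
  simp only [h1, fenchelGap, dualVal, Finset.sum_add_distrib, Finset.sum_sub_distrib, ← sum_inner,
    ha.y_sum, ← Finset.sum_mul, ← Finset.sum_div, ha.s_sum, inner_sub_left, real_inner_smul_left,
    Problem.reduced]
  ring

/-! ### The dual objective of a state -/

theorem Admissible.exists_represents (hE : StronglyConnected E) (ha : st.Admissible P) :
    ∃ z, st.Represents P z := by
  obtain ⟨z, hz, hp, ht⟩ := exists_dualVar hE st.z
    (WithLp.toLp 2 fun α => st.sAll α • P.mbar - st.yAll α) (by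
      simp only [Finset.sum_sub_distrib, ← Finset.sum_smul, ha.s_sum, ha.y_sum, sub_sub_cancel])
  refine ⟨z, fun i => by simp [hz, nodeVec], fun i α hα => by simp [hz, nodeVec, hα], hp,
    fun α => ?_⟩
  rw [ht]
  change _ = _ - (_ - _)
  rw [sub_sub_cancel]

theorem Admissible.majObj_eq_sum (ha : st.Admissible P) {z : DualVar V E m}
    (hz : st.Represents P z) : st.majObj P z = ∑ i, conj (st.maj P i) (st.z i) +
      ((∑ α, energy (st.sAll α) (st.yAll α) : ℝ) : EReal) := by
  rw [majObj, dualObj_eq hz.2.1 hz.2.2.1, coe_sum_ereal]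
  congr 1
  · simp only [hz.1]
  · refine Finset.sum_congr rfl fun α _ => ?_
    rw [← hz.2.2.2 α, quad_eq_energy (ha.y_zero α)]

theorem Admissible.majObj_eq (ha : st.Admissible P) (h : st.FiniteConj P) {z : DualVar V E m}
    (hz : st.Represents P z) : st.majObj P z = ((st.dualVal P : ℝ) : EReal) := by
  rw [ha.majObj_eq_sum hz, dualVal, EReal.coe_add, coe_sum_ereal Finset.univ (st.conjVal P)]
  simp only [coe_conjVal (h _)]

theorem Admissible.majObj_eq_top (ha : st.Admissible P) (h : ¬ st.FiniteConj P)
    {z : DualVar V E m} (hz : st.Represents P z) : st.majObj P z = ⊤ := by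
  unfold FiniteConj at h
  push Not at h
  obtain ⟨i, hi⟩ := h
  rw [ha.majObj_eq_sum hz, ereal_sum_eq_top (fun i _ => conj_ne_bot _ _) (Finset.mem_univ i) hi]
  exact EReal.top_add_of_ne_bot (EReal.coe_ne_bot _)

/-! ### Operation A -/

theorem outDeg1_pos (E : Finset (V × V)) (i : V) : 0 < outDeg1 E i := by
  unfold outDeg1; positivity

theorem sum_ite_out {M : Type*} [AddCommGroup M] [Module ℝ M] (E : Finset (V × V)) (i : V)
    (c : M) : ∑ e : {e : V × V // e ∈ E}, (if e.1.1 = i then c else 0) =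
      (outDeg1 E i - 1) • c := by
  rw [Finset.sum_coe_sort E (fun e => if e.1 = i then c else 0), ← Finset.sum_filter,
    Finset.sum_const, outDeg1, add_sub_cancel_right, Nat.cast_smul_eq_nsmul]

theorem opA_s (i j : V) : (st.opA i).s j =
    st.s j + if j = i then (outDeg1 E i)⁻¹ • st.s i - st.s i else 0 := by
  by_cases h : j = i
  · subst h; simp [opA, div_eq_inv_mul]
  · simp [opA, h]

theorem opA_y (i j : V) : (st.opA i).y j =
    st.y j + if j = i then (outDeg1 E i)⁻¹ • st.y i - st.y i else 0 := by
  by_cases h : j = i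
  · subst h; simp [opA]
  · simp [opA, h]

theorem opA_edge_s (i : V) (e : {e : V × V // e ∈ E}) : (st.opA i).sAll (Sum.inr e) =
    st.sAll (Sum.inr e) + if e.1.1 = i then (outDeg1 E i)⁻¹ • st.s i else 0 := by
  by_cases h : e.1.1 = i
  · subst h; simp [opA, sAll, div_eq_inv_mul]; ring
  · simp [opA, sAll, h]

theorem opA_edge_y (i : V) (e : {e : V × V // e ∈ E}) : (st.opA i).yAll (Sum.inr e) =
    st.yAll (Sum.inr e) + if e.1.1 = i then (outDeg1 E i)⁻¹ • st.y i else 0 := by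
  by_cases h : e.1.1 = i
  · subst h; simp [opA, yAll]; abel
  · simp [opA, yAll, h]

theorem opA_s_self (i : V) : (st.opA i).s i = (outDeg1 E i)⁻¹ * st.s i := by
  simp [opA_s]

theorem opA_y_self (i : V) : (st.opA i).y i = (outDeg1 E i)⁻¹ • st.y i := by
  simp [opA_y]

/-- Conservation: the `outDeg1 E i - 1` outgoing edges gain one share each, which is what `i` gives
away. It serves for weights and for data. -/
theorem sum_opA {M : Type*} [AddCommGroup M] [Module ℝ M] (i : V) (v : V → M)
    (w : {e : V × V // e ∈ E} → M) :
    ∑ j, (v j + if j = i then (outDeg1 E i)⁻¹ • v i - v i else 0) +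
      ∑ e : {e : V × V // e ∈ E}, (w e + if e.1.1 = i then (outDeg1 E i)⁻¹ • v i else 0) =
      ∑ j, v j + ∑ e, w e := by
  have hd := (outDeg1_pos E i).ne'
  rw [Finset.sum_add_distrib, Finset.sum_add_distrib, sum_ite_out, Finset.sum_ite_eq',
    if_pos (Finset.mem_univ i), sub_smul, smul_inv_smul₀ hd, one_smul]
  abel

theorem Admissible.opA (ha : st.Admissible P) (i : V) : (st.opA i).Admissible P where
  s_pos j := by
    have := outDeg1_pos E i
    rcases eq_or_ne j i with rfl | h
    · rw [opA_s_self]; have := ha.s_pos j; positivity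
    · simpa [opA_s, h] using ha.s_pos j
  s_nonneg α := by
    have := outDeg1_pos E i
    have hi := ha.s_pos i
    rcases α with j | e
    · rcases eq_or_ne j i with rfl | h
      · change 0 ≤ (st.opA j).s j
        rw [opA_s_self]; positivity
      · simpa [sAll, opA_s, h] using (ha.s_pos j).le
    · rw [opA_edge_s]
      have := ha.s_nonneg (Sum.inr e)
      rw [smul_eq_mul]
      split_ifs <;> positivity
  s_sum := by
    rw [← ha.s_sum, Fintype.sum_sum_type, Fintype.sum_sum_type]
    simp only [opA_edge_s]
    change ∑ j, (st.opA i).s j + _ = ∑ j, st.s j + _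
    simp only [opA_s]
    exact sum_opA i st.s fun e => st.sAll (Sum.inr e)
  y_zero α := by
    have hi := ha.s_pos i
    have hd := outDeg1_pos E i
    rcases α with j | e
    · intro h
      change (st.opA i).s j = 0 at h
      rcases eq_or_ne j i with rfl | hj
      · rw [opA_s_self] at h
        exact absurd h (by positivity)
      · simp only [opA_s, if_neg hj, add_zero] at h
        exact absurd h (ha.s_pos j).ne'
    · rw [opA_edge_s, opA_edge_y]
      have := ha.s_nonneg (Sum.inr e)
      split_ifs
      · intro h
        rw [smul_eq_mul] at h
        exact absurd h (by positivity)
      · simpa using ha.y_zero (Sum.inr e)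
  y_sum := by
    have h := ha.y_sum
    rw [Fintype.sum_sum_type] at h ⊢
    simp only [opA_edge_y]
    change ∑ j, (st.opA i).y j + _ = _ - ∑ j, st.z j
    simp only [opA_y]
    rw [← h]
    exact sum_opA i st.y fun e => st.yAll (Sum.inr e)
  affine := ha.affine
  minorant := ha.minorant

/-- The energy is homogeneous of degree one in `(s, y)`, so splitting data into equal shares costs
nothing. -/
theorem energy_div (s d : ℝ) (hd : d ≠ 0) (y : X m) :
    energy (d⁻¹ * s) (d⁻¹ • y) = d⁻¹ * energy s y := by
  rw [energy_eq_div, energy_eq_div, norm_smul, mul_pow, Real.norm_eq_abs, sq_abs]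
  rcases eq_or_ne s 0 with rfl | hs
  · simp
  · field_simp

/-- After the free splitting, one share stays at `i` and one is merged into each outgoing edge, so
the decrease is the sum of the losses of these merges. -/
theorem dualVal_sub_opA (i : V) : st.dualVal P - (st.opA i).dualVal P =
    ∑ e : {e : V × V // e ∈ E}, (if e.1.1 = i then
      energy ((st.opA i).s i) ((st.opA i).y i) + energy (st.sAll (Sum.inr e)) (st.yAll (Sum.inr e)) -
      energy ((st.opA i).sAll (Sum.inr e)) ((st.opA i).yAll (Sum.inr e)) else 0) := by
  have hd := (outDeg1_pos E i).ne'
  have h1 (e : {e : V × V // e ∈ E}) : (if e.1.1 = i then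
      energy ((st.opA i).s i) ((st.opA i).y i) + energy (st.sAll (Sum.inr e)) (st.yAll (Sum.inr e)) -
      energy ((st.opA i).sAll (Sum.inr e)) ((st.opA i).yAll (Sum.inr e)) else 0) =
      (if e.1.1 = i then (outDeg1 E i)⁻¹ • energy (st.s i) (st.y i) else 0) +
      (energy (st.sAll (Sum.inr e)) (st.yAll (Sum.inr e)) -
      energy ((st.opA i).sAll (Sum.inr e)) ((st.opA i).yAll (Sum.inr e))) := by
    split_ifs with h
    · rw [opA_s_self, opA_y_self, energy_div _ _ hd, smul_eq_mul]; ring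
    · simp [opA_edge_s, opA_edge_y, h]
  have h2 (j : V) : energy ((st.opA i).s j) ((st.opA i).y j) = energy (st.s j) (st.y j) +
      if j = i then (outDeg1 E i)⁻¹ • energy (st.s i) (st.y i) - energy (st.s i) (st.y i) else 0 := by
    split_ifs with h
    · subst h
      rw [opA_s_self, opA_y_self, energy_div _ _ hd, smul_eq_mul]; ring
    · simp [opA_s, opA_y, h]
  have h3 : ∑ j, (st.opA i).conjVal P j = ∑ j, st.conjVal P j := rfl
  simp only [dualVal, h1, h3, Fintype.sum_sum_type, Finset.sum_add_distrib, Finset.sum_sub_distrib]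
  rw [sum_ite_out]
  change _ + (∑ j, energy (st.s j) (st.y j) + _) -
    (_ + (∑ j, energy ((st.opA i).s j) ((st.opA i).y j) + _)) = _
  simp only [h2, Finset.sum_add_distrib, Finset.sum_ite_eq', Finset.mem_univ, if_true, smul_eq_mul]
  field_simp
  ring

/-! ### Operation B -/

theorem opB_s (e : {e : V × V // e ∈ E}) (j : V) : (st.opB e).s j =
    st.s j + if j = e.1.2 then st.sAll (Sum.inr e) else 0 := by
  by_cases h : j = e.1.2
  · subst h; simp [opB, sAll]; ring
  · simp [opB, h]

theorem opB_y (e : {e : V × V // e ∈ E}) (j : V) : (st.opB e).y j =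
    st.y j + if j = e.1.2 then st.yAll (Sum.inr e) else 0 := by
  by_cases h : j = e.1.2
  · subst h; simp [opB, yAll]; abel
  · simp [opB, h]

theorem opB_edge_s (e e' : {e : V × V // e ∈ E}) : (st.opB e).sAll (Sum.inr e') =
    st.sAll (Sum.inr e') - if e' = e then st.sAll (Sum.inr e) else 0 := by
  by_cases h : e' = e
  · subst h; simp [opB, sAll]
  · simp [opB, sAll, h]

theorem opB_edge_y (e e' : {e : V × V // e ∈ E}) : (st.opB e).yAll (Sum.inr e') =
    st.yAll (Sum.inr e') - if e' = e then st.yAll (Sum.inr e) else 0 := by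
  by_cases h : e' = e
  · subst h; simp [opB, yAll]
  · simp [opB, yAll, h]

theorem sum_opB {M : Type*} [AddCommGroup M] (e : {e : V × V // e ∈ E}) (v : V → M)
    (w : {e : V × V // e ∈ E} → M) :
    ∑ j, (v j + if j = e.1.2 then w e else 0) + ∑ e', (w e' - if e' = e then w e else 0) =
      ∑ j, v j + ∑ e', w e' := by
  rw [Finset.sum_add_distrib, Finset.sum_sub_distrib, Finset.sum_ite_eq', Finset.sum_ite_eq',
    if_pos (Finset.mem_univ _), if_pos (Finset.mem_univ _)]
  abel

theorem Admissible.opB (ha : st.Admissible P) (e : {e : V × V // e ∈ E}) :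
    (st.opB e).Admissible P where
  s_pos j := by
    rw [opB_s]
    have := ha.s_pos j
    have := ha.s_nonneg (Sum.inr e)
    split_ifs <;> positivity
  s_nonneg α := by
    have := ha.s_nonneg (Sum.inr e)
    rcases α with j | e'
    · change 0 ≤ (st.opB e).s j
      rw [opB_s]
      have := ha.s_pos j
      split_ifs <;> positivity
    · rw [opB_edge_s]
      split_ifs with h
      · subst h; simp
      · simpa using ha.s_nonneg (Sum.inr e')
  s_sum := by
    rw [← ha.s_sum, Fintype.sum_sum_type, Fintype.sum_sum_type]
    simp only [opB_edge_s]
    change ∑ j, (st.opB e).s j + _ = ∑ j, st.s j + _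
    simp only [opB_s]
    exact sum_opB e st.s fun e => st.sAll (Sum.inr e)
  y_zero α := by
    rcases α with j | e'
    · intro h
      change (st.opB e).s j = 0 at h
      rw [opB_s] at h
      have := ha.s_pos j
      have := ha.s_nonneg (Sum.inr e)
      exfalso
      split_ifs at h <;> linarith
    · rw [opB_edge_s, opB_edge_y]
      split_ifs with h
      · subst h; simp
      · simpa using ha.y_zero (Sum.inr e')
  y_sum := by
    have h := ha.y_sum
    rw [Fintype.sum_sum_type] at h ⊢
    simp only [opB_edge_y]
    change ∑ j, (st.opB e).y j + _ = _ - ∑ j, st.z j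
    simp only [opB_y]
    rw [← h]
    exact sum_opB e st.y fun e => st.yAll (Sum.inr e)
  affine := ha.affine
  minorant := ha.minorant

/-- The data of the edge are merged into its head, and the emptied edge has no energy. -/
theorem dualVal_sub_opB (e : {e : V × V // e ∈ E}) : st.dualVal P - (st.opB e).dualVal P =
    energy (st.s e.1.2) (st.y e.1.2) + energy (st.sAll (Sum.inr e)) (st.yAll (Sum.inr e)) -
      energy ((st.opB e).s e.1.2) ((st.opB e).y e.1.2) := by
  have h1 (e' : {e : V × V // e ∈ E}) :
      energy ((st.opB e).sAll (Sum.inr e')) ((st.opB e).yAll (Sum.inr e')) =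
      energy (st.sAll (Sum.inr e')) (st.yAll (Sum.inr e')) -
        if e' = e then energy (st.sAll (Sum.inr e)) (st.yAll (Sum.inr e)) else 0 := by
    rw [opB_edge_s, opB_edge_y]
    split_ifs with h
    · subst h; simp [energy_zero_right]
    · simp
  have h2 (j : V) : energy ((st.opB e).s j) ((st.opB e).y j) = energy (st.s j) (st.y j) +
      if j = e.1.2 then energy ((st.opB e).s e.1.2) ((st.opB e).y e.1.2) -
        energy (st.s e.1.2) (st.y e.1.2) else 0 := by
    split_ifs with h
    · subst h; ring
    · simp [opB_s, opB_y, h]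
  have h3 : ∑ j, (st.opB e).conjVal P j = ∑ j, st.conjVal P j := rfl
  simp only [dualVal, h3, Fintype.sum_sum_type]
  change _ + (∑ j, energy (st.s j) (st.y j) + _) -
    (_ + (∑ j, energy ((st.opB e).s j) ((st.opB e).y j) + _)) = _
  rw [Finset.sum_congr rfl fun j _ => h2 j, Finset.sum_congr rfl fun e' _ => h1 e',
    Finset.sum_add_distrib, Finset.sum_sub_distrib, Finset.sum_ite_eq', Finset.sum_ite_eq',
    if_pos (Finset.mem_univ _), if_pos (Finset.mem_univ _)]
  ring

end State

/-! ### Operation C -/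

/-- What operation C at node `j` achieves, whichever way the node is treated: `x` is the new
primal value. -/
structure ProxStep (P : Problem V m) (σ : ℝ) (j : V) (x : X m) (st st' : State V E m) : Prop where
  sAll_eq : ∀ α, st'.sAll α = st.sAll α
  yAll_eq : ∀ α, α ≠ Sum.inl j → st'.yAll α = st.yAll α
  y_self : st'.y j = st.s j • x
  z_self : st'.z j = st.y j + st.z j - st.s j • x
  z_eq : ∀ i, i ≠ j → st'.z i = st.z i
  fa_eq : ∀ i, i ≠ j → st'.fa i = st.fa i
  conj_eq : conj (st'.maj P j) (st'.z j) =
    ((inner ℝ (st'.z j) x - st'.maj P j x : ℝ) : EReal)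
  le_conj : ((inner ℝ (st.z j) x - st'.maj P j x : ℝ) : EReal) ≤ conj (st.maj P j) (st.z j)
  gap_le : P.f j x - st'.maj P j x ≤ 2 * (1 / σ) * ‖x - st.x (Sum.inl j)‖ ^ 2
  affine : j ∉ P.V₁ → ∃ b : ℝ, ∀ w, st'.fa j w = inner ℝ (st'.z j) w + b
  minorant : j ∉ P.V₁ → ∀ w, st'.fa j w ≤ P.f j w

theorem convexOn_inner_add {H : Type*} [NormedAddCommGroup H] [InnerProductSpace ℝ H] (v : H)
    (b : ℝ) : ConvexOn ℝ Set.univ fun w : H => inner ℝ v w + b := by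
  refine ⟨convex_univ, fun x _ y _ p q _ _ h => le_of_eq ?_⟩
  simp only [inner_add_right, real_inner_smul_right, smul_eq_mul]
  linear_combination (-b) * h

namespace State

variable {P : Problem V m} {st st' : State V E m} {σ : ℝ}

theorem smul_xtemp_sub (ha : st.Admissible P) (j : V) (x : X m) :
    st.s j • (st.xtemp j - x) = st.y j + st.z j - st.s j • x := by
  rw [smul_sub, xtemp, smul_inv_smul₀ (ha.s_pos j).ne']

theorem OpCProx.proxStep (hP : P.Smooth σ) (hσ : 0 < σ) (ha : st.Admissible P) {j : V}
    (hj : j ∈ P.V₁) (h : OpCProx P j st st') : ∃ x, ProxStep P σ j x st st' := by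
  obtain ⟨x, hmin, rfl⟩ := h
  have hsub (w : X m) : P.f j x + inner ℝ (st.s j • (st.xtemp j - x)) (w - x) ≤ P.f j w := by
    refine subgradient_of_isMinOn (hP j).1 (fun w hw => ?_) w
    have := hmin hw
    simp only [Set.mem_ofPred_eq, norm_sub_rev (st.xtemp j)] at this ⊢
    linarith
  refine ⟨x, ?_⟩
  constructor
  · rintro (i | e) <;> rfl
  · rintro (i | e) hα
    · have hi : i ≠ j := fun h => hα (by rw [h])
      simp [yAll, hi]
    · rfl
  · simp
  · simp [smul_xtemp_sub ha]
  · intro i hi; simp [hi]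
  · intro i hi; rfl
  · simp only [maj, if_pos hj, Function.update_self]
    exact conj_eq_of_subgradient hsub
  · simp only [maj, if_pos hj]
    exact DistDyk.le_conj _ _ _
  · simp only [maj, if_pos hj, sub_self]
    positivity
  · exact fun h => absurd hj h
  · exact fun h => absurd hj h

theorem OpCSub.proxStep (hP : P.Smooth σ) (ha : st.Admissible P) {j : V}
    (hj : j ∉ P.V₁) (h : OpCSub P j st st') : ∃ x, ProxStep P σ j x st st' := by
  obtain ⟨v, x, hv, hmin, rfl⟩ := h
  obtain ⟨b, hb⟩ := ha.affine j hj
  -- The step is a proximal step for the cutting-plane model `M`. The new affine minorant supports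
  -- `M` at `x` and so stays below `P.f j`.
  set M : X m → ℝ := fun w => max (st.fa j w) (linz P j st v w) with hM
  have hlin (w : X m) : linz P j st v w =
      inner ℝ v w + (P.f j (st.x (Sum.inl j)) - inner ℝ v (st.x (Sum.inl j))) := by
    rw [linz, inner_sub_right]; ring
  have hMconv : ConvexOn ℝ Set.univ M := by
    have h1 : ConvexOn ℝ Set.univ (st.fa j) := by
      rw [funext hb]; exact convexOn_inner_add _ _
    have h2 : ConvexOn ℝ Set.univ (linz P j st v) := by
      rw [funext hlin]; exact convexOn_inner_add _ _
    exact h1.sup h2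
  have hMle (w : X m) : M w ≤ P.f j w := max_le (ha.minorant j hj w) (hv w)
  have hsub := subgradient_of_isMinOn hMconv hmin
  set z' := st.s j • (st.xtemp j - x) with hz'
  have hfa' (w : X m) : inner ℝ z' (w - x) + M x = inner ℝ z' w + (M x - inner ℝ z' x) := by
    rw [inner_sub_right]; ring
  refine ⟨x, ?_⟩
  constructor
  · rintro (i | e) <;> rfl
  · rintro (i | e) hα
    · have hi : i ≠ j := fun h => hα (by rw [h])
      simp [yAll, hi]
    · rfl
  · simp
  · simp [hz', smul_xtemp_sub ha]
  · intro i hi; simp [hi]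
  · intro i hi; simp [hi]
  · simp only [maj, if_neg hj, Function.update_self]
    rw [conj_affine hfa']
    simp only [sub_self, inner_zero_right, zero_add]
    rw [neg_sub]
  · simp only [maj, if_neg hj, Function.update_self, sub_self, inner_zero_right, zero_add]
    refine le_trans ?_ (DistDyk.le_conj (st.fa j) (st.z j) x)
    exact EReal.coe_le_coe_iff.2 (sub_le_sub_left (le_max_left _ _) _)
  · simp only [maj, if_neg hj, Function.update_self, sub_self, inner_zero_right, zero_add]
    -- The linearization is exact at the old primal value, so its gap at `x` is purely quadratic;
    -- the gap of `M` is no larger.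
    have h1 := gap_le_of_affine_minorant (hP j).1 (hP j).2.1 (hP j).2.2
      (fun w => (hlin w).symm.trans_le (hv w)) (st.x (Sum.inl j)) x
    have h2 : linz P j st v x ≤ max (st.fa j x) (linz P j st v x) := le_max_right _ _
    rw [hlin x] at h2 ⊢
    linarith
  · intro _
    exact ⟨M x - inner ℝ z' x, fun w => by simp only [Function.update_self]; exact hfa' w⟩
  · intro _ w
    simp only [Function.update_self]
    have := hsub w
    have := hMle w
    change inner ℝ z' (w - x) + M x ≤ _
    linarith

end State

namespace ProxStep

variable {P : Problem V m} {st st' : State V E m} {σ : ℝ} {j : V} {x : X m}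

theorem s_eq (h : ProxStep P σ j x st st') (i : V) : st'.s i = st.s i := h.sAll_eq (Sum.inl i)

theorem maj_eq (h : ProxStep P σ j x st st') (i : V) (hi : i ≠ j) : st'.maj P i = st.maj P i := by
  unfold State.maj
  rw [h.fa_eq i hi]

theorem conjVal_eq (h : ProxStep P σ j x st st') (i : V) (hi : i ≠ j) :
    st'.conjVal P i = st.conjVal P i := by
  rw [State.conjVal, State.conjVal, h.maj_eq i hi, h.z_eq i hi]

theorem x_eq (h : ProxStep P σ j x st st') (α : Idx V E) (hα : α ≠ Sum.inl j) :
    st'.x α = st.x α := by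
  rw [State.x, State.x, h.sAll_eq, h.yAll_eq α hα]

theorem x_self (h : ProxStep P σ j x st st') (ha : st.Admissible P) : st'.x (Sum.inl j) = x := by
  rw [State.x, h.sAll_eq]
  change (st.s j)⁻¹ • st'.y j = x
  rw [h.y_self, inv_smul_smul₀ (ha.s_pos j).ne']

theorem conjVal_self (h : ProxStep P σ j x st st') :
    st'.conjVal P j = inner ℝ (st'.z j) x - st'.maj P j x := by
  rw [State.conjVal, h.conj_eq, EReal.toReal_coe]

theorem admissible (h : ProxStep P σ j x st st') (ha : st.Admissible P) : st'.Admissible P where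
  s_pos i := by rw [h.s_eq]; exact ha.s_pos i
  s_nonneg α := by rw [h.sAll_eq]; exact ha.s_nonneg α
  s_sum := by simp only [h.sAll_eq, ha.s_sum]
  y_zero α hα := by
    rw [h.sAll_eq] at hα
    rw [h.yAll_eq α, ha.y_zero α hα]
    rintro rfl
    exact (ha.s_pos j).ne' hα
  y_sum := by
    have h1 : ∑ α, (st'.yAll α - st.yAll α) = st'.y j - st.y j :=
      Finset.sum_eq_single_of_mem (Sum.inl j) (Finset.mem_univ _) fun α _ hα => by
        rw [h.yAll_eq α hα, sub_self]
    have h2 : ∑ i, (st'.z i - st.z i) = st'.z j - st.z j :=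
      Finset.sum_eq_single_of_mem j (Finset.mem_univ _) fun i _ hi => by
        rw [h.z_eq i hi, sub_self]
    rw [Finset.sum_sub_distrib, sub_eq_iff_eq_add] at h1 h2
    rw [h1, h2, ha.y_sum, h.z_self, h.y_self]
    abel
  affine i hi := by
    rcases eq_or_ne i j with rfl | hij
    · exact h.affine hi
    · rw [h.fa_eq i hij, h.z_eq i hij]; exact ha.affine i hi
  minorant i hi := by
    rcases eq_or_ne i j with rfl | hij
    · exact h.minorant hi
    · rw [h.fa_eq i hij]; exact ha.minorant i hi

theorem finiteConj (h : ProxStep P σ j x st st') (hf : st.FiniteConj P) : st'.FiniteConj P := by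
  intro i
  rcases eq_or_ne i j with rfl | hij
  · rw [h.conj_eq]; exact EReal.coe_ne_top _
  · rw [h.maj_eq i hij, h.z_eq i hij]; exact hf i

/-- Fenchel–Young holds at `x` for the old dual variable, and with equality for the new one. The
model values cancel, and the inner products complete the square with the energies. -/
theorem dualVal_le (h : ProxStep P σ j x st st') (ha : st.Admissible P) (hf : st.FiniteConj P) :
    st.s j / 2 * ‖x - st.x (Sum.inl j)‖ ^ 2 ≤ st.dualVal P - st'.dualVal P := by
  have h1 : ∑ i, (st.conjVal P i - st'.conjVal P i) = st.conjVal P j - st'.conjVal P j :=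
    Finset.sum_eq_single_of_mem j (Finset.mem_univ _) fun i _ hi => by
      rw [h.conjVal_eq i hi, sub_self]
  have h2 : ∑ α, (energy (st.sAll α) (st.yAll α) - energy (st'.sAll α) (st'.yAll α)) =
      energy (st.s j) (st.y j) - energy (st'.s j) (st'.y j) :=
    Finset.sum_eq_single_of_mem (Sum.inl j) (Finset.mem_univ _) fun α _ hα => by
      rw [h.sAll_eq, h.yAll_eq α hα, sub_self]
  have h3 := h.le_conj
  rw [← State.coe_conjVal (hf j), EReal.coe_le_coe_iff] at h3
  have hs := (ha.s_pos j).ne'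
  have h4 : st.y j = st.s j • st.x (Sum.inl j) := (smul_inv_smul₀ hs _).symm
  rw [Finset.sum_sub_distrib] at h1 h2
  have h5 : st'.z j = st.z j + st.s j • st.x (Sum.inl j) - st.s j • x := by
    rw [h.z_self, h4]; abel
  have h6 := h.conjVal_self
  rw [h.s_eq, h.y_self, h4, energy_smul hs, energy_smul hs] at h2
  rw [h5, inner_sub_left, inner_add_left, real_inner_smul_left, real_inner_smul_left,
    real_inner_self_eq_norm_sq] at h6
  rw [norm_sub_sq_real, real_inner_comm]
  simp only [State.dualVal]
  linarith

/-- The new conjugate is attained at `x`, so the Fenchel gap there is the error of the new model. -/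
theorem fenchelGap_le (h : ProxStep P σ j x st st') (ha : st.Admissible P) :
    st'.fenchelGap P j (st'.x (Sum.inl j)) ≤ 2 * (1 / σ) * ‖x - st.x (Sum.inl j)‖ ^ 2 := by
  have := h.gap_le
  rw [h.x_self ha, State.fenchelGap, h.conjVal_self]
  linarith

end ProxStep

theorem Op.Step.proxStep {P : Problem V m} {σ : ℝ} (hP : P.Smooth σ) (hσ : 0 < σ)
    {st st' : State V E m} (ha : st.Admissible P) {j : V} (h : (Op.C j : Op V E).Step P st st') :
    ∃ x, ProxStep P σ j x st st' := by
  rcases h with ⟨hj, h⟩ | ⟨hj, h⟩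
  · exact h.proxStep hP hσ ha hj
  · exact h.proxStep hP ha hj

namespace Op.Step

variable {P : Problem V m} {σ : ℝ} {st st' : State V E m} {o : Op V E}

theorem admissible (hP : P.Smooth σ) (hσ : 0 < σ) (ha : st.Admissible P)
    (h : o.Step P st st') : st'.Admissible P := by
  rcases o with i | e | j
  · obtain rfl : st' = st.opA i := h
    exact ha.opA i
  · obtain rfl : st' = st.opB e := h
    exact ha.opB e
  · obtain ⟨x, hx⟩ := h.proxStep hP hσ ha
    exact hx.admissible ha

theorem finiteConj (hP : P.Smooth σ) (hσ : 0 < σ) (ha : st.Admissible P)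
    (h : o.Step P st st') (hf : st.FiniteConj P) : st'.FiniteConj P := by
  rcases o with i | e | j
  · obtain rfl : st' = st.opA i := h
    exact hf
  · obtain rfl : st' = st.opB e := h
    exact hf
  · obtain ⟨x, hx⟩ := h.proxStep hP hσ ha
    exact hx.finiteConj hf

end Op.Step

/-! ### Decrease of the dual value in one operation -/

/-- The decrease of the dual objective in one operation bounds the squared distances of the primal
values involved, up to the factor `c`. -/
structure StepBound (P : Problem V m) (c : ℝ) (o : Op V E) (st st' : State V E m) : Prop where
  node : ∀ i, c * ‖st'.x (Sum.inl i) - st.x (Sum.inl i)‖ ^ 2 ≤ st.dualVal P - st'.dualVal P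
  send : ∀ e, o = Op.A e.1.1 → st'.sAll (Sum.inr e) ≠ 0 ∧
    c * ‖st'.x (Sum.inr e) - st.x (Sum.inl e.1.1)‖ ^ 2 ≤ st.dualVal P - st'.dualVal P
  edge : ∀ e, o ≠ Op.B e → st.sAll (Sum.inr e) ≠ 0 → st'.sAll (Sum.inr e) ≠ 0 ∧
    c * ‖st'.x (Sum.inr e) - st.x (Sum.inr e)‖ ^ 2 ≤ st.dualVal P - st'.dualVal P
  recv : ∀ e, o = Op.B e → st.sAll (Sum.inr e) ≠ 0 →
    c * ‖st.x (Sum.inr e) - st.x (Sum.inl e.1.2)‖ ^ 2 ≤ st.dualVal P - st'.dualVal P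

section StepBound

variable {P : Problem V m} {σ μ : ℝ} {st st' : State V E m}

theorem ProxStep.stepBound {j : V} {x : X m} (h : ProxStep P σ j x st st')
    (ha : st.Admissible P) (hf : st.FiniteConj P) (hμ : 0 < μ) (hw : st.WeightsGE μ) :
    StepBound P (μ / 4) (Op.C j) st st' := by
  have hd := h.dualVal_le ha hf
  have hs := hw.node_le ha j
  have hd0 : 0 ≤ st.dualVal P - st'.dualVal P := by
    have := ha.s_pos j
    exact le_trans (by positivity) hd
  constructor
  · intro i
    rcases eq_or_ne i j with rfl | hi
    · rw [h.x_self ha]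
      refine le_trans ?_ hd
      have : μ / 4 ≤ st.s i / 2 := by linarith
      gcongr
    · rw [h.x_eq _ (by simpa using hi)]; simpa using hd0
  · intro e he; cases he
  · intro e _ he
    rw [h.sAll_eq, h.x_eq _ (by simp)]
    exact ⟨he, by simpa using hd0⟩
  · intro e he; cases he

/-- The loss of a merge bounds the distance of the merged value from either ingredient: from the
share of `i` for `send`, from the old edge value for `edge`. Node values do not move, as `y` and `s`
are scaled alike. -/
theorem State.Admissible.stepBound_opA (ha : st.Admissible P) (hμ : 0 < μ) (hw : st.WeightsGE μ)
    (i : V) (hw' : (st.opA i).WeightsGE μ) : StepBound P (μ / 4) (Op.A i) st (st.opA i) := by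
  have hd := (State.outDeg1_pos E i).ne'
  have hs' := hw'.node_le (ha.opA i) i
  have hcond (e : {e : V × V // e ∈ E}) :
      (st.sAll (Sum.inr e) = 0 ∧ st.yAll (Sum.inr e) = 0) ∨ μ ≤ st.sAll (Sum.inr e) :=
    (hw (Sum.inr e)).imp_left fun h => ⟨h, ha.y_zero _ h⟩
  have hmerge (e : {e : V × V // e ∈ E}) (he : e.1.1 = i) :
      (st.opA i).sAll (Sum.inr e) = (st.opA i).s i + st.sAll (Sum.inr e) ∧
      (st.opA i).yAll (Sum.inr e) = (st.opA i).y i + st.yAll (Sum.inr e) := by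
    rw [State.opA_edge_s, State.opA_edge_y, if_pos he, if_pos he, State.opA_s_self,
      State.opA_y_self, add_comm, add_comm (st.yAll _), smul_eq_mul]
    exact ⟨rfl, rfl⟩
  have hterm (e : {e : V × V // e ∈ E}) : 0 ≤ if e.1.1 = i then energy ((st.opA i).s i)
      ((st.opA i).y i) + energy (st.sAll (Sum.inr e)) (st.yAll (Sum.inr e)) -
      energy ((st.opA i).sAll (Sum.inr e)) ((st.opA i).yAll (Sum.inr e)) else 0 := by
    split_ifs with he
    · have := energy_merge_left_le hμ hs' (y := (st.opA i).y i) (hcond e)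
      rw [(hmerge e he).1, (hmerge e he).2]
      have : 0 ≤ μ / 4 * ‖((st.opA i).s i + st.sAll (Sum.inr e))⁻¹ •
        ((st.opA i).y i + st.yAll (Sum.inr e)) - ((st.opA i).s i)⁻¹ • (st.opA i).y i‖ ^ 2 := by
          positivity
      linarith
    · exact le_rfl
  have hsum := State.dualVal_sub_opA (P := P) (st := st) i
  have hd0 : 0 ≤ st.dualVal P - (st.opA i).dualVal P := by
    rw [hsum]; exact Finset.sum_nonneg fun e _ => hterm e
  have hle (e : {e : V × V // e ∈ E}) (he : e.1.1 = i) : energy ((st.opA i).s i)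
      ((st.opA i).y i) + energy (st.sAll (Sum.inr e)) (st.yAll (Sum.inr e)) -
      energy ((st.opA i).sAll (Sum.inr e)) ((st.opA i).yAll (Sum.inr e)) ≤
      st.dualVal P - (st.opA i).dualVal P := by
    have := Finset.single_le_sum (fun e _ => hterm e) (Finset.mem_univ e)
    rw [if_pos he] at this
    rwa [hsum]
  have hx (j : V) : (st.opA i).x (Sum.inl j) = st.x (Sum.inl j) := by
    change ((st.opA i).s j)⁻¹ • (st.opA i).y j = (st.s j)⁻¹ • st.y j
    rcases eq_or_ne j i with rfl | hj
    · rw [State.opA_s_self, State.opA_y_self, mul_inv, inv_inv, mul_comm, mul_smul,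
        smul_inv_smul₀ hd]
    · simp [State.opA_s, State.opA_y, hj]
  constructor
  · intro j; rw [hx]; simpa using hd0
  · intro e he
    obtain rfl : i = e.1.1 := by simpa using he
    have h1 := energy_merge_left_le hμ hs' (y := (st.opA e.1.1).y e.1.1) (hcond e)
    have h2 := hle e rfl
    have h3 := ha.s_nonneg (Sum.inr e)
    rw [← hx]
    change _ ∧ _ * ‖((st.opA e.1.1).sAll (Sum.inr e))⁻¹ • (st.opA e.1.1).yAll (Sum.inr e) -
      ((st.opA e.1.1).s e.1.1)⁻¹ • (st.opA e.1.1).y e.1.1‖ ^ 2 ≤ _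
    rw [(hmerge e rfl).1, (hmerge e rfl).2] at h2 ⊢
    exact ⟨by linarith, by linarith⟩
  · intro e _ he
    by_cases hei : e.1.1 = i
    · have hse := (hw (Sum.inr e)).resolve_left he
      have h1 := energy_merge_left_le hμ hse (y := st.yAll (Sum.inr e)) (u := (st.opA i).y i)
        (Or.inr hs')
      have h2 := hle e hei
      change _ ∧ _ * ‖((st.opA i).sAll (Sum.inr e))⁻¹ • (st.opA i).yAll (Sum.inr e) -
        (st.sAll (Sum.inr e))⁻¹ • st.yAll (Sum.inr e)‖ ^ 2 ≤ _
      rw [(hmerge e hei).1, (hmerge e hei).2, add_comm ((st.opA i).s i),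
        add_comm ((st.opA i).y i)] at h2 ⊢
      exact ⟨by linarith, by linarith⟩
    · rw [State.x, State.x, State.opA_edge_s, State.opA_edge_y, if_neg hei, if_neg hei]
      simpa [he] using hd0
  · intro e he; cases he

/-- The loss of the merge bounds the motion of the head and, if the edge carries weight, the
distance of the two merged values. -/
theorem State.Admissible.stepBound_opB (ha : st.Admissible P) (hμ : 0 < μ) (hw : st.WeightsGE μ)
    (e : {e : V × V // e ∈ E}) : StepBound P (μ / 4) (Op.B e) st (st.opB e) := by
  have hs := hw.node_le ha e.1.2
  have hcond : (st.sAll (Sum.inr e) = 0 ∧ st.yAll (Sum.inr e) = 0) ∨ μ ≤ st.sAll (Sum.inr e) :=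
    (hw (Sum.inr e)).imp_left fun h => ⟨h, ha.y_zero _ h⟩
  have hsum := State.dualVal_sub_opB (P := P) (st := st) e
  have h1 := energy_merge_left_le hμ hs (y := st.y e.1.2) hcond
  have hs' : (st.opB e).s e.1.2 = st.s e.1.2 + st.sAll (Sum.inr e) := by simp [State.opB_s]
  have hy' : (st.opB e).y e.1.2 = st.y e.1.2 + st.yAll (Sum.inr e) := by simp [State.opB_y]
  have hnode : μ / 4 * ‖(st.opB e).x (Sum.inl e.1.2) - st.x (Sum.inl e.1.2)‖ ^ 2 ≤
      st.dualVal P - (st.opB e).dualVal P := by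
    change _ * ‖((st.opB e).s e.1.2)⁻¹ • (st.opB e).y e.1.2 - (st.s e.1.2)⁻¹ • st.y e.1.2‖ ^ 2 ≤ _
    rw [hsum, hs', hy']
    linarith
  have hd0 : 0 ≤ st.dualVal P - (st.opB e).dualVal P := le_trans (by positivity) hnode
  constructor
  · intro j
    rcases eq_or_ne j e.1.2 with rfl | hj
    · exact hnode
    · have : (st.opB e).x (Sum.inl j) = st.x (Sum.inl j) := by
        change ((st.opB e).s j)⁻¹ • (st.opB e).y j = (st.s j)⁻¹ • st.y j
        simp [State.opB_s, State.opB_y, hj]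
      rw [this]; simpa using hd0
  · intro e' he; cases he
  · intro e' hne he
    have hee : e' ≠ e := fun h => hne (by rw [h])
    rw [State.x, State.x, State.opB_edge_s, State.opB_edge_y, if_neg hee, if_neg hee]
    simpa [he] using hd0
  · intro e' he hse
    obtain rfl : e = e' := by simpa using he
    have h2 := energy_merge_le hμ hs ((hw (Sum.inr e)).resolve_left hse) (st.y e.1.2)
      (st.yAll (Sum.inr e))
    rw [norm_sub_rev] at h2
    change _ * ‖(st.sAll (Sum.inr e))⁻¹ • st.yAll (Sum.inr e) - (st.s e.1.2)⁻¹ • st.y e.1.2‖ ^ 2 ≤ _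
    rw [hsum, hs', hy']
    linarith

theorem Op.Step.stepBound {o : Op V E} (hP : P.Smooth σ) (hσ : 0 < σ) (hμ : 0 < μ)
    (ha : st.Admissible P) (hf : st.FiniteConj P) (hw : st.WeightsGE μ) (hw' : st'.WeightsGE μ)
    (h : o.Step P st st') : StepBound P (μ / 4) o st st' := by
  rcases o with i | e | j
  · obtain rfl : st' = st.opA i := h
    exact ha.stepBound_opA hμ hw i hw'
  · obtain rfl : st' = st.opB e := h
    exact ha.stepBound_opB hμ hw e
  · obtain ⟨x, hx⟩ := h.proxStep hP hσ ha
    exact hx.stepBound ha hf hμ hw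

end StepBound

end Graph

/-! ### Sequences of operations -/

section Graph

variable {V : Type*} [Fintype V] [DecidableEq V] {E : Finset (V × V)} {m : ℕ}

theorem finite_op (E : Finset (V × V)) : Finite (Op V E) := by
  let f : Op V E → V ⊕ ({e : V × V // e ∈ E} ⊕ V)
    | Op.A i => Sum.inl i
    | Op.B e => Sum.inr (Sum.inl e)
    | Op.C j => Sum.inr (Sum.inr j)
  refine Finite.of_injective f ?_
  rintro (i | e | j) (i' | e' | j') h <;> simp_all [f]

theorem length_le_card_op {l : List (Op V E)} (h : l.Nodup) : l.length ≤ Nat.card (Op V E) := by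
  have := finite_op E
  have := Fintype.ofFinite (Op V E)
  rw [Nat.card_eq_fintype_card]
  exact h.length_le_card

theorem outDeg1_le (E : Finset (V × V)) (i : V) : State.outDeg1 E i ≤ E.card + 1 := by
  unfold State.outDeg1
  gcongr
  exact Finset.filter_subset _ _

/-- `Steps` through states whose positive weights are all at least `μ`. -/
def BoundedSteps (P : Problem V m) (μ : ℝ) : List (Op V E) → State V E m → State V E m → Prop
  | [], st, st' => st' = st ∧ st.WeightsGE μ
  | o :: l, st, st' => st.WeightsGE μ ∧ ∃ mid, o.Step P st mid ∧ BoundedSteps P μ l mid st'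

variable {P : Problem V m} {σ μ : ℝ} {st st' st'' : State V E m} {l l' : List (Op V E)}

theorem Steps.admissible (hP : P.Smooth σ) (hσ : 0 < σ) (ha : st.Admissible P)
    (h : Steps P l st st') : st'.Admissible P := by
  induction l generalizing st with
  | nil => cases h; exact ha
  | cons o l ih =>
    obtain ⟨mid, ho, hl⟩ := h
    exact ih (ho.admissible hP hσ ha) hl

/-- Operation C makes the conjugate at its node finite and no operation destroys finiteness. An
infinite value can come only from the initial dual variable at a node of V₁. -/
theorem Steps.conj_ne_top (hP : P.Smooth σ) (hσ : 0 < σ) (ha : st.Admissible P)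
    (h : Steps P l st st') {j : V} (hj : Op.C j ∈ l ∨ conj (st.maj P j) (st.z j) ≠ ⊤) :
    conj (st'.maj P j) (st'.z j) ≠ ⊤ := by
  induction l generalizing st with
  | nil => cases h; simpa using hj
  | cons o l ih =>
    obtain ⟨mid, ho, hl⟩ := h
    refine ih (ho.admissible hP hσ ha) hl ?_
    rw [List.mem_cons, or_assoc, or_left_comm] at hj
    refine hj.imp_right fun hj => ?_
    rcases o with i | e | i
    · obtain rfl : mid = st.opA i := ho
      exact hj.resolve_left (by simp)
    · obtain rfl : mid = st.opB e := ho
      exact hj.resolve_left (by simp)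
    · obtain ⟨x, hx⟩ := ho.proxStep hP hσ ha
      rcases eq_or_ne j i with rfl | hij
      · rw [hx.conj_eq]; exact EReal.coe_ne_top _
      · rw [hx.maj_eq j hij, hx.z_eq j hij]
        exact hj.resolve_left (by simpa using hij)

theorem Steps.finiteConj (hP : P.Smooth σ) (hσ : 0 < σ) (ha : st.Admissible P)
    (h : Steps P l st st') (hf : st.FiniteConj P) : st'.FiniteConj P :=
  fun i => h.conj_ne_top hP hσ ha (Or.inr (hf i))

/-- As no operation is repeated, the weights stay bounded below during an iteration. -/
theorem Steps.boundedSteps (hP : P.Smooth σ) (hσ : 0 < σ) {smin : ℝ} (hsmin : 0 < smin)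
    (hμ : μ * (E.card + 1) = smin) (ha : st.Admissible P) (h : Steps P l st st') (hl : l.Nodup)
    (hA : ∀ i, Op.A i ∈ l → smin ≤ st.s i) (hw : st.WeightsGE μ) : BoundedSteps P μ l st st' := by
  induction l generalizing st with
  | nil => exact ⟨h, hw⟩
  | cons o l ih =>
    obtain ⟨mid, ho, hrest⟩ := h
    rw [List.nodup_cons] at hl
    have hA' (i) (hi : Op.A i ∈ l) := hA i (List.mem_cons_of_mem o hi)
    refine ⟨hw, mid, ho, ih (ho.admissible hP hσ ha) hrest hl.2 ?_ ?_⟩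
    · intro i hi
      rcases o with i' | e | j
      · obtain rfl : mid = st.opA i' := ho
        have : i ≠ i' := by rintro rfl; exact hl.1 hi
        simpa [State.opA_s, this] using hA' i hi
      · obtain rfl : mid = st.opB e := ho
        have := ha.s_nonneg (Sum.inr e)
        have := hA' i hi
        rw [State.opB_s]
        split_ifs <;> linarith
      · obtain ⟨x, hx⟩ := ho.proxStep hP hσ ha
        rw [hx.s_eq]
        exact hA' i hi
    · rcases o with i | e | j
      · obtain rfl : mid = st.opA i := ho
        have hd := State.outDeg1_pos E i
        -- Until its only operation A in the iteration, a node can only gain weight; so it still has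
        -- at least `smin` when it is divided by at most `E.card + 1`.
        have hi : μ ≤ (State.outDeg1 E i)⁻¹ * st.s i := by
          have h1 := hA i List.mem_cons_self
          have h2 : μ * State.outDeg1 E i ≤ smin := by
            have hμ0 : 0 ≤ μ := by
              by_contra! hneg
              have : (0 : ℝ) < E.card + 1 := by positivity
              nlinarith
            rw [← hμ]
            exact mul_le_mul_of_nonneg_left (outDeg1_le E i) hμ0
          rw [inv_mul_eq_div, le_div_iff₀ hd]
          linarith
        rintro (j | e)
        · rcases eq_or_ne j i with rfl | hj
          · right
            change μ ≤ (st.opA j).s j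
            rwa [State.opA_s_self]
          · have := hw (Sum.inl j)
            simpa [State.sAll, State.opA_s, hj] using this
        · rw [State.opA_edge_s]
          split_ifs
          · right
            have := ha.s_nonneg (Sum.inr e)
            rw [smul_eq_mul]
            linarith
          · simpa using hw (Sum.inr e)
      · obtain rfl : mid = st.opB e := ho
        rintro (j | e')
        · right
          change μ ≤ (st.opB e).s j
          have := ha.s_nonneg (Sum.inr e)
          have := hw.node_le ha j
          rw [State.opB_s]
          split_ifs <;> linarith
        · rw [State.opB_edge_s]
          split_ifs with he
          · left; rw [he, sub_self]
          · simpa using hw (Sum.inr e')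
      · obtain ⟨x, hx⟩ := ho.proxStep hP hσ ha
        intro α
        rw [hx.sAll_eq]
        exact hw α

namespace BoundedSteps

theorem weightsGE (h : BoundedSteps P μ l st st') : st.WeightsGE μ := by
  cases l with
  | nil => exact h.2
  | cons => exact h.1

theorem append (h : BoundedSteps P μ l st st') (h' : BoundedSteps P μ l' st' st'') :
    BoundedSteps P μ (l ++ l') st st'' := by
  induction l generalizing st with
  | nil => obtain ⟨rfl, _⟩ := h; exact h'
  | cons o l ih =>
    obtain ⟨hw, mid, ho, hl⟩ := h
    exact ⟨hw, mid, ho, ih hl⟩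

theorem dualVal_le [Nonempty V] (hP : P.Smooth σ) (hσ : 0 < σ) (hμ : 0 < μ) (ha : st.Admissible P)
    (hf : st.FiniteConj P) (h : BoundedSteps P μ l st st') : st'.dualVal P ≤ st.dualVal P := by
  induction l generalizing st with
  | nil => rw [h.1]
  | cons o l ih =>
    obtain ⟨hw, mid, ho, hl⟩ := h
    have h1 := ih (ho.admissible hP hσ ha) (ho.finiteConj hP hσ ha hf) hl
    have h2 := (ho.stepBound hP hσ hμ ha hf hw hl.weightsGE).node (Classical.arbitrary V)
    have h3 : 0 ≤ μ / 4 * ‖mid.x (Sum.inl (Classical.arbitrary V)) -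
      st.x (Sum.inl (Classical.arbitrary V))‖ ^ 2 := by positivity
    linarith

theorem _root_.DistDyk.norm_le_of_mul_sq_le {c d η : ℝ} (hc : 0 < c) (hη : 0 ≤ η) {v : X m}
    (h1 : c * ‖v‖ ^ 2 ≤ d) (h2 : d ≤ c * η ^ 2) : ‖v‖ ≤ η :=
  (sq_le_sq₀ (norm_nonneg v) hη).1 (le_of_mul_le_mul_left (h1.trans h2) hc)

/-- An edge whose data are received later holds data close to those of its head. -/
theorem norm_edge_sub_le [Nonempty V] (hP : P.Smooth σ) (hσ : 0 < σ) (hμ : 0 < μ)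
    (ha : st.Admissible P) (hf : st.FiniteConj P) (h : BoundedSteps P μ l st st')
    {η : ℝ} (hη : 0 ≤ η) (hdec : st.dualVal P - st'.dualVal P ≤ μ / 4 * η ^ 2)
    {e : {e : V × V // e ∈ E}} (he : Op.B e ∈ l) (hs : st.sAll (Sum.inr e) ≠ 0) :
    ‖st.x (Sum.inr e) - st.x (Sum.inl e.1.2)‖ ≤ 2 * l.length * η := by
  induction l generalizing st with
  | nil => simp at he
  | cons o l ih =>
    obtain ⟨hw, mid, ho, hl⟩ := h
    have hc : 0 < μ / 4 := by positivity
    have ha' := ho.admissible hP hσ ha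
    have hf' := ho.finiteConj hP hσ ha hf
    have hb := ho.stepBound hP hσ hμ ha hf hw hl.weightsGE
    have hd1 := hl.dualVal_le hP hσ hμ ha' hf'
    have hd2 : 0 ≤ st.dualVal P - mid.dualVal P :=
      le_trans (by positivity) (hb.node (Classical.arbitrary V))
    have hstep : st.dualVal P - mid.dualVal P ≤ μ / 4 * η ^ 2 := by linarith
    have hrest : mid.dualVal P - st'.dualVal P ≤ μ / 4 * η ^ 2 := by linarith
    have hln : (0 : ℝ) ≤ l.length * η := by positivity
    rw [List.length_cons]
    push_cast
    by_cases hoe : o = Op.B e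
    · have := norm_le_of_mul_sq_le hc hη (hb.recv e hoe hs) hstep
      linarith
    -- Before the receipt, each operation moves the edge value and the head value by at most `η`
    -- each, hence the factor 2 per operation.
    · have h1 := hb.edge e hoe hs
      have h2 := norm_le_of_mul_sq_le hc hη h1.2 hstep
      have h3 := norm_le_of_mul_sq_le hc hη (hb.node e.1.2) hstep
      have h4 := ih ha' hf' hl hrest ((List.mem_cons.1 he).resolve_left (Ne.symm hoe)) h1.1
      have h5 : st.x (Sum.inr e) - st.x (Sum.inl e.1.2) =
          -(mid.x (Sum.inr e) - st.x (Sum.inr e)) + (mid.x (Sum.inr e) - mid.x (Sum.inl e.1.2)) +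
          (mid.x (Sum.inl e.1.2) - st.x (Sum.inl e.1.2)) := by abel
      have h6 := norm_add₃_le (a := -(mid.x (Sum.inr e) - st.x (Sum.inr e)))
        (b := mid.x (Sum.inr e) - mid.x (Sum.inl e.1.2))
        (c := mid.x (Sum.inl e.1.2) - st.x (Sum.inl e.1.2))
      rw [← h5, norm_neg] at h6
      linarith

/-- Nodes between which data are sent and received hold close data. -/
theorem norm_node_sub_le [Nonempty V] (hP : P.Smooth σ) (hσ : 0 < σ) (hμ : 0 < μ)
    (ha : st.Admissible P) (hf : st.FiniteConj P) (h : BoundedSteps P μ l st st')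
    {η : ℝ} (hη : 0 ≤ η) (hdec : st.dualVal P - st'.dualVal P ≤ μ / 4 * η ^ 2)
    {e : {e : V × V // e ∈ E}} (he : List.Sublist [Op.A e.1.1, Op.B e] l) :
    ‖st.x (Sum.inl e.1.1) - st.x (Sum.inl e.1.2)‖ ≤ 2 * l.length * η := by
  induction l generalizing st with
  | nil => simp at he
  | cons o l ih =>
    obtain ⟨hw, mid, ho, hl⟩ := h
    have hc : 0 < μ / 4 := by positivity
    have ha' := ho.admissible hP hσ ha
    have hf' := ho.finiteConj hP hσ ha hf
    have hb := ho.stepBound hP hσ hμ ha hf hw hl.weightsGE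
    have hd1 := hl.dualVal_le hP hσ hμ ha' hf'
    have hd2 : 0 ≤ st.dualVal P - mid.dualVal P :=
      le_trans (by positivity) (hb.node (Classical.arbitrary V))
    have hstep : st.dualVal P - mid.dualVal P ≤ μ / 4 * η ^ 2 := by linarith
    have hrest : mid.dualVal P - st'.dualVal P ≤ μ / 4 * η ^ 2 := by linarith
    have h3 := norm_le_of_mul_sq_le hc hη (hb.node e.1.2) hstep
    rw [List.length_cons]
    push_cast
    -- `u` is the value still to be compared with the head: that of the edge if this operation is
    -- the sending, that of the tail otherwise.
    suffices ∃ u : X m, ‖u - st.x (Sum.inl e.1.1)‖ ≤ η ∧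
        ‖u - mid.x (Sum.inl e.1.2)‖ ≤ 2 * l.length * η by
      obtain ⟨u, h2, h4⟩ := this
      have h5 : st.x (Sum.inl e.1.1) - st.x (Sum.inl e.1.2) =
          -(u - st.x (Sum.inl e.1.1)) + (u - mid.x (Sum.inl e.1.2)) +
          (mid.x (Sum.inl e.1.2) - st.x (Sum.inl e.1.2)) := by abel
      have h6 := norm_add₃_le (a := -(u - st.x (Sum.inl e.1.1)))
        (b := u - mid.x (Sum.inl e.1.2))
        (c := mid.x (Sum.inl e.1.2) - st.x (Sum.inl e.1.2))
      rw [← h5, norm_neg] at h6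
      linarith
    by_cases hoe : o = Op.A e.1.1
    · subst hoe
      rw [List.cons_sublist_cons, List.singleton_sublist] at he
      obtain ⟨hs, h1⟩ := hb.send e rfl
      exact ⟨mid.x (Sum.inr e), norm_le_of_mul_sq_le hc hη h1 hstep,
        hl.norm_edge_sub_le hP hσ hμ ha' hf' hη hrest he hs⟩
    · have he' : List.Sublist [Op.A e.1.1, Op.B e] l := by
        cases he with
        | cons _ h => exact h
        | cons_cons _ h => exact absurd rfl hoe
      exact ⟨mid.x (Sum.inl e.1.1), norm_le_of_mul_sq_le hc hη (hb.node e.1.1) hstep,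
        ih ha' hf' hl hrest he'⟩

/-- It carries the estimate obtained when C acts on `j` to the end of the iteration: C on another
node changes neither the data nor the model of `j`. -/
theorem unchanged_of_forall_prox (hP : P.Smooth σ) (hσ : 0 < σ) (ha : st.Admissible P)
    (h : BoundedSteps P μ l st st') (hl : ∀ o ∈ l, ∃ i, o = Op.C i) {j : V} (hj : Op.C j ∉ l) :
    st'.x (Sum.inl j) = st.x (Sum.inl j) ∧ st'.fenchelGap P j = st.fenchelGap P j := by
  induction l generalizing st with
  | nil => rw [h.1]; exact ⟨rfl, rfl⟩
  | cons o l ih =>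
    obtain ⟨hw, mid, ho, hrest⟩ := h
    obtain ⟨i, rfl⟩ := hl o List.mem_cons_self
    rw [List.mem_cons, not_or] at hj
    have hji : j ≠ i := by rintro rfl; exact hj.1 rfl
    obtain ⟨x, hx⟩ := ho.proxStep hP hσ ha
    obtain ⟨h1, h2⟩ := ih (hx.admissible ha) hrest (fun o ho => hl o (List.mem_cons_of_mem _ ho)) hj.2
    refine ⟨h1.trans (hx.x_eq _ (by simpa using hji)), h2.trans ?_⟩
    funext w
    rw [State.fenchelGap, State.fenchelGap, hx.conjVal_eq j hji, hx.z_eq j hji]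

/-- After operation C has been performed on every node, the Fenchel gaps at the primal values are
bounded by the decrease of the dual objective. -/
theorem fenchelGap_le_of_forall_prox [Nonempty V] (hP : P.Smooth σ) (hσ : 0 < σ) (hμ : 0 < μ)
    (ha : st.Admissible P) (hf : st.FiniteConj P) (h : BoundedSteps P μ l st st') (hnd : l.Nodup)
    (hl : ∀ o ∈ l, ∃ i, o = Op.C i) {j : V} (hj : Op.C j ∈ l) :
    μ / 4 * st'.fenchelGap P j (st'.x (Sum.inl j)) ≤
      2 * (1 / σ) * (st.dualVal P - st'.dualVal P) := by
  have hσ' : 0 < 2 * (1 / σ) := by positivity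
  induction l generalizing st with
  | nil => simp at hj
  | cons o l ih =>
    obtain ⟨hw, mid, ho, hrest⟩ := h
    obtain ⟨i, rfl⟩ := hl o List.mem_cons_self
    have hl' := fun o ho => hl o (List.mem_cons_of_mem _ ho)
    rw [List.nodup_cons] at hnd
    have hb := ho.stepBound hP hσ hμ ha hf hw hrest.weightsGE
    obtain ⟨x, hx⟩ := ho.proxStep hP hσ ha
    have ha' := hx.admissible ha
    have hf' := hx.finiteConj hf
    have hd1 := hrest.dualVal_le hP hσ hμ ha' hf'
    rcases List.mem_cons.1 hj with hji | hj
    -- Here C acts on `j`: the squared displacement bounds the gap and is itself bounded by the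
    -- decrease.
    · obtain rfl : j = i := by simpa using hji
      obtain ⟨h1, h2⟩ := hrest.unchanged_of_forall_prox hP hσ ha' hl' hnd.1
      have h3 := hx.fenchelGap_le ha
      have h4 := hb.node j
      rw [hx.x_self ha] at h3 h4
      rw [h1, h2, hx.x_self ha]
      calc μ / 4 * mid.fenchelGap P j x
          ≤ μ / 4 * (2 * (1 / σ) * ‖x - st.x (Sum.inl j)‖ ^ 2) := by gcongr
        _ = 2 * (1 / σ) * (μ / 4 * ‖x - st.x (Sum.inl j)‖ ^ 2) := by ring
        _ ≤ 2 * (1 / σ) * (st.dualVal P - st'.dualVal P) := by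
          refine mul_le_mul_of_nonneg_left ?_ hσ'.le
          linarith
    · refine (ih ha' hf' hrest hnd.2 hl' hj).trans (mul_le_mul_of_nonneg_left ?_ hσ'.le)
      have : 0 ≤ st.dualVal P - mid.dualVal P := le_trans (by positivity) (hb.node j)
      linarith

end BoundedSteps

/-- In a strongly connected graph, differences along edges control all differences. -/
theorem exists_norm_sub_le (hE : StronglyConnected E) : ∃ M : ℕ, ∀ (m : ℕ) (x : V → X m) (δ : ℝ),
    0 ≤ δ → (∀ e ∈ E, ‖x e.1 - x e.2‖ ≤ δ) → ∀ i j, ‖x i - x j‖ ≤ M * δ := by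
  -- `M` is the length of a path, fixed before `m`, `x` and `δ`; the sum over all pairs then serves
  -- uniformly.
  have hpath (i j : V) : ∃ M : ℕ, ∀ (m : ℕ) (x : V → X m) (δ : ℝ),
      (∀ e ∈ E, ‖x e.1 - x e.2‖ ≤ δ) → ‖x i - x j‖ ≤ M * δ := by
    induction hE i j with
    | refl => exact ⟨0, fun m x δ _ => by simp⟩
    | @tail b c _ h ih =>
      obtain ⟨M, hM⟩ := ih
      refine ⟨M + 1, fun m x δ hδ => ?_⟩
      have h1 := hM m x δ hδ
      have h2 := hδ _ h
      have h3 := norm_sub_le_norm_sub_add_norm_sub (x i) (x b) (x c)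
      push_cast
      linarith
  choose M hM using hpath
  refine ⟨∑ i, ∑ j, M i j, fun m x δ hδ h i j => (hM i j m x δ h).trans ?_⟩
  have h1 : M i j ≤ ∑ j, M i j := Finset.single_le_sum (fun _ _ => Nat.zero_le _) (Finset.mem_univ j)
  have h2 : ∑ j, M i j ≤ ∑ i, ∑ j, M i j :=
    Finset.single_le_sum (f := fun i => ∑ j, M i j) (fun _ _ => Nat.zero_le _) (Finset.mem_univ i)
  have h3 : (M i j : ℝ) ≤ (∑ i, ∑ j, M i j : ℕ) := by exact_mod_cast h1.trans h2
  exact mul_le_mul_of_nonneg_right h3 hδ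

end Graph

/-! ### Runs and windows -/

section Graph

variable {V : Type*} [Fintype V] [DecidableEq V] {E : Finset (V × V)} {m : ℕ}
variable {P : Problem V m} {σ μ smin smax : ℝ} {st : ℕ → State V E m} {ops : ℕ → List (Op V E)}

namespace IsRun

theorem admissible (hP : P.Smooth σ) (hσ : 0 < σ) (h : IsRun P st ops) (k : ℕ) :
    (st k).Admissible P := by
  induction k with
  | zero => exact h.init
  | succ k ih => exact (h.step k).admissible hP hσ ih

theorem finiteConj (hP : P.Smooth σ) (hσ : 0 < σ) (h : IsRun P st ops) {k : ℕ}
    (hf : (st k).FiniteConj P) (n : ℕ) : (st (k + n)).FiniteConj P := by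
  induction n with
  | zero => exact hf
  | succ n ih => exact (h.step (k + n)).finiteConj hP hσ (h.admissible hP hσ _) ih

theorem le_s (hP : P.Smooth σ) (hσ : 0 < σ) (h : IsRun P st ops)
    (hw : WeightsBounded smin smax st) (k : ℕ) (i : V) : smin ≤ (st k).s i :=
  (hw k (Sum.inl i) ((h.admissible hP hσ k).s_pos i)).1

theorem boundedSteps (hP : P.Smooth σ) (hσ : 0 < σ) (hsmin : 0 < smin)
    (hμ : μ * (E.card + 1) = smin) (h : IsRun P st ops) (hw : WeightsBounded smin smax st)
    (k : ℕ) : BoundedSteps P μ (ops k) (st k) (st (k + 1)) := by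
  refine (h.step k).boundedSteps hP hσ hsmin hμ (h.admissible hP hσ k) (h.nodup k)
    (fun i _ => h.le_s hP hσ hw k i) fun α => ?_
  have hle : μ ≤ smin := by
    have : (0 : ℝ) < E.card + 1 := by positivity
    have : 0 < μ := pos_of_mul_pos_left (hμ ▸ hsmin) this.le
    nlinarith [(Nat.cast_nonneg E.card : (0 : ℝ) ≤ _)]
  rcases ((h.admissible hP hσ k).s_nonneg α).eq_or_lt with h0 | h0
  · exact Or.inl h0.symm
  · exact Or.inr (hle.trans (hw k α h0).1)

/-- Joining the iterations into one list keeps its length bounded in terms of the graph and `n`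
alone, so the constants are uniform over all runs. -/
theorem exists_boundedSteps (hP : P.Smooth σ) (hσ : 0 < σ) (hsmin : 0 < smin)
    (hμ : μ * (E.card + 1) = smin) (h : IsRun P st ops) (hw : WeightsBounded smin smax st)
    (k n : ℕ) : ∃ l, BoundedSteps P μ l (st k) (st (k + n)) ∧
      l.length ≤ n * Nat.card (Op V E) ∧ ∀ j < n, List.Sublist (ops (k + j)) l := by
  induction n with
  | zero => exact ⟨[], ⟨rfl, (h.boundedSteps hP hσ hsmin hμ hw k).weightsGE⟩, by simp, by simp⟩
  | succ n ih =>
    obtain ⟨l, hl, hlen, hsub⟩ := ih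
    refine ⟨l ++ ops (k + n), hl.append (h.boundedSteps hP hσ hsmin hμ hw (k + n)), ?_, ?_⟩
    · rw [List.length_append, Nat.succ_mul]
      exact Nat.add_le_add hlen (length_le_card_op (h.nodup _))
    · intro j hj
      rcases Nat.lt_succ_iff_lt_or_eq.1 hj with hj | rfl
      · exact (hsub j hj).trans (List.sublist_append_left _ _)
      · exact List.sublist_append_right _ _

theorem dualVal_le [Nonempty V] (hP : P.Smooth σ) (hσ : 0 < σ) (hsmin : 0 < smin)
    (h : IsRun P st ops) (hw : WeightsBounded smin smax st) {k : ℕ} (hf : (st k).FiniteConj P)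
    (n : ℕ) : (st (k + n)).dualVal P ≤ (st k).dualVal P := by
  have hE0 : (0 : ℝ) < E.card + 1 := by positivity
  obtain ⟨l, hl, _⟩ := h.exists_boundedSteps hP hσ hsmin (div_mul_cancel₀ smin hE0.ne') hw k n
  exact hl.dualVal_le hP hσ (by positivity) (h.admissible hP hσ k) hf

end IsRun

theorem State.Admissible.sum_sq_le {s : State V E m} (ha : s.Admissible P)
    (hf : s.FiniteConj P) (w : X m) :
    ∑ α, s.sAll α / 2 * ‖s.x α - w‖ ^ 2 ≤ s.dualVal P + P.reduced w := by
  rw [ha.dualVal_add_reduced]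
  have : 0 ≤ ∑ i, s.fenchelGap P i w := Finset.sum_nonneg fun i _ => ha.fenchelGap_nonneg hf i w
  linarith

/-- If the primal values have distance at most `r` and the Fenchel gaps at them are at most `ε`,
the duality gap is small. -/
theorem State.Admissible.dualGap_le [Nonempty V] {s : State V E m} (hP : P.Smooth σ) (hσ : 0 < σ)
    (ha : s.Admissible P) (hf : s.FiniteConj P) {x w : X m} (hx : ∀ w, P.reduced x ≤ P.reduced w)
    {r ε : ℝ} (hr : ∀ α, s.sAll α ≠ 0 → ‖s.x α - w‖ ≤ r)
    (hε : ∀ i, s.fenchelGap P i (s.x (Sum.inl i)) ≤ ε) :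
    s.dualVal P + P.reduced x ≤ Fintype.card V * (2 * ε + 2 * (1 / σ) * r ^ 2) +
      Fintype.card V / 2 * r ^ 2 := by
  have h1 : ∑ i, s.fenchelGap P i w ≤ ∑ _i : V, (2 * ε + 2 * (1 / σ) * r ^ 2) := by
    refine Finset.sum_le_sum fun i _ => (ha.fenchelGap_le hP hf i (s.x (Sum.inl i)) w).trans ?_
    have h2 := hr (Sum.inl i) (ha.s_pos i).ne'
    rw [norm_sub_rev] at h2
    have := hε i
    gcongr
  have h3 : ∑ α, s.sAll α / 2 * ‖s.x α - w‖ ^ 2 ≤ ∑ α, s.sAll α / 2 * r ^ 2 := by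
    refine Finset.sum_le_sum fun α _ => ?_
    have h0 := ha.s_nonneg α
    rcases eq_or_ne (s.sAll α) 0 with h | h
    · simp [h]
    · have := hr α h
      gcongr
  rw [Finset.sum_const, Finset.card_univ, nsmul_eq_mul] at h1
  rw [← Finset.sum_mul, ← Finset.sum_div, ha.s_sum] at h3
  -- The splitting is used at `w`: replacing the minimizer by `w` can only increase the left side.
  have := ha.dualVal_add_reduced w
  linarith [hx w]

/-- The duality gap at the end of a window is bounded by the decrease over the window. -/
theorem exists_window_bound [Nonempty V] (hE : StronglyConnected E) (hsmin : 0 < smin)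
    (hσ : 0 < σ) {K : ℕ} (hK : 0 < K) : ∃ G : ℝ, 0 < G ∧ ∀ (m : ℕ) (P : Problem V m), P.Smooth σ →
      ∀ (st : ℕ → State V E m) (ops : ℕ → List (Op V E)), IsRun P st ops →
      ∀ smax, WeightsBounded smin smax st → ∀ x, (∀ w, P.reduced x ≤ P.reduced w) →
      ∀ k, IsWindow K ops k → (st k).FiniteConj P →
        (st (k + K)).dualVal P + P.reduced x ≤
          G * ((st k).dualVal P - (st (k + K)).dualVal P) := by
  obtain ⟨M, hM⟩ := exists_norm_sub_le hE
  have hE0 : (0 : ℝ) < E.card + 1 := by positivity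
  have hN : (0 : ℝ) < Fintype.card V := by exact_mod_cast Fintype.card_pos
  set μ := smin / (E.card + 1) with hμdef
  have hμ : 0 < μ := by positivity
  have hμE : μ * (E.card + 1) = smin := div_mul_cancel₀ smin hE0.ne'
  set c := μ / 4 with hc
  have hc0 : 0 < c := by positivity
  -- `n` bounds the number of operations. Values along an edge differ by at most 2nη; `M` such steps
  -- join two nodes and one more joins an edge to its head, which gives `B`. `G₁` and `G₂` are the
  -- resulting coefficients of `D₁` and `D₂`.
  set n : ℝ := K * Nat.card (Op V E) with hn
  set B : ℝ := (M + 1) * (2 * n) with hB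
  set G₁ : ℝ := Fintype.card V * (2 * (2 * (1 / σ) / c)) with hG₁
  set G₂ : ℝ := (Fintype.card V * (2 * (1 / σ)) + Fintype.card V / 2) * B ^ 2 / c with hG₂
  have hG₁0 : 0 < G₁ := by positivity
  have hG₂0 : 0 ≤ G₂ := by positivity
  refine ⟨G₁ + G₂, by positivity, ?_⟩
  intro m P hP st ops hrun smax hw x hx k hwin hf
  have ha := hrun.admissible hP hσ
  have hf1 : (st (k + 1)).FiniteConj P := hrun.finiteConj hP hσ hf 1
  have hfirst := hrun.boundedSteps hP hσ hsmin hμE hw k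
  have hd1 := hfirst.dualVal_le hP hσ hμ (ha k) hf
  -- All estimates refer to the iterate `k + 1`, after C on all nodes and before the communication.
  obtain ⟨l, hl, hlen, hsub⟩ := hrun.exists_boundedSteps hP hσ hsmin hμE hw (k + 1) (K - 1)
  have hkK : k + 1 + (K - 1) = k + K := by omega
  rw [hkK] at hl
  have hd2 := hl.dualVal_le hP hσ hμ (ha _) hf1
  set D₁ := (st k).dualVal P - (st (k + 1)).dualVal P with hD₁
  set D₂ := (st (k + 1)).dualVal P - (st (k + K)).dualVal P with hD₂
  have hD₂0 : 0 ≤ D₂ := by linarith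
  have hD₁0 : 0 ≤ D₁ := by linarith
  -- With c η² = D₂, no later operation can move a value by more than `η`.
  set η := √(D₂ / c) with hη
  have hη0 : 0 ≤ η := Real.sqrt_nonneg _
  have hη2 : η ^ 2 = D₂ / c := Real.sq_sqrt (by positivity)
  have hdec : D₂ ≤ μ / 4 * η ^ 2 := by rw [hη2, ← hc, mul_div_cancel₀ _ hc0.ne']
  have hlen' : 2 * (l.length : ℝ) * η ≤ 2 * n * η := by
    have : (l.length : ℝ) ≤ n := by
      rw [hn]
      exact_mod_cast hlen.trans (Nat.mul_le_mul_right _ (Nat.sub_le K 1))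
    gcongr
  have hAB (e : {e : V × V // e ∈ E}) : List.Sublist [Op.A e.1.1, Op.B e] l := by
    obtain ⟨j, hj1, hj2, hj⟩ := hwin.2 e
    have h1 := hsub (j - 1) (by omega)
    rw [show k + 1 + (j - 1) = k + j by omega] at h1
    exact hj.trans h1
  have hnode (i j : V) : ‖(st (k + 1)).x (Sum.inl i) - (st (k + 1)).x (Sum.inl j)‖ ≤
      M * (2 * n * η) := by
    refine hM m (fun i => (st (k + 1)).x (Sum.inl i)) _ (by positivity) (fun e he => ?_) i j
    exact (hl.norm_node_sub_le hP hσ hμ (ha _) hf1 hη0 hdec (hAB ⟨e, he⟩)).trans hlen'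
  have hedge (e : {e : V × V // e ∈ E}) (he : (st (k + 1)).sAll (Sum.inr e) ≠ 0) :
      ‖(st (k + 1)).x (Sum.inr e) - (st (k + 1)).x (Sum.inl e.1.2)‖ ≤ 2 * n * η :=
    (hl.norm_edge_sub_le hP hσ hμ (ha _) hf1 hη0 hdec
      ((hAB e).subset (by simp)) he).trans hlen'
  have hn0 : 0 ≤ 2 * n * η := by positivity
  have hr (α : Idx V E) (hα : (st (k + 1)).sAll α ≠ 0) :
      ‖(st (k + 1)).x α - (st (k + 1)).x (Sum.inl (Classical.arbitrary V))‖ ≤ B * η := by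
    have hBη : B * η = M * (2 * n * η) + 2 * n * η := by rw [hB]; ring
    rw [hBη]
    rcases α with i | e
    · linarith [hnode i (Classical.arbitrary V)]
    · have h1 := hedge e hα
      have h2 := hnode e.1.2 (Classical.arbitrary V)
      have h3 := norm_sub_le_norm_sub_add_norm_sub ((st (k + 1)).x (Sum.inr e))
        ((st (k + 1)).x (Sum.inl e.1.2)) ((st (k + 1)).x (Sum.inl (Classical.arbitrary V)))
      linarith
  have hε (i : V) : (st (k + 1)).fenchelGap P i ((st (k + 1)).x (Sum.inl i)) ≤
      2 * (1 / σ) / c * D₁ := by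
    have h1 := hfirst.fenchelGap_le_of_forall_prox hP hσ hμ (ha k) hf (hrun.nodup k)
      (fun o ho => (hwin.1 o).1 ho) ((hwin.1 (Op.C i)).2 ⟨i, rfl⟩)
    rw [div_mul_eq_mul_div, le_div_iff₀ hc0, mul_comm _ c]
    exact h1
  have hgap := (ha (k + 1)).dualGap_le hP hσ hf1 hx hr hε
  rw [mul_pow, hη2] at hgap
  have hsplit : Fintype.card V * (2 * (2 * (1 / σ) / c * D₁) + 2 * (1 / σ) * (B ^ 2 * (D₂ / c))) +
      Fintype.card V / 2 * (B ^ 2 * (D₂ / c)) = G₁ * D₁ + G₂ * D₂ := by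
    rw [hG₁, hG₂]; ring
  rw [hsplit] at hgap
  have h1 : (st k).dualVal P - (st (k + K)).dualVal P = D₁ + D₂ := by rw [hD₁, hD₂]; ring
  rw [h1]
  -- The gap at `k + K` is at most that at `k + 1`, and the cross terms G₁ D₂ and G₂ D₁ are
  -- nonnegative.
  nlinarith [mul_nonneg hG₁0.le hD₂0, mul_nonneg hG₂0 hD₁0]

/-- A bound on the squares along a geometrically decreasing subsequence gives linear
convergence. -/
theorem exists_linear_bound {ι : Type*} [Fintype ι] {a : ℕ → ι → ℝ} {d : ℕ → ℝ} {ρ A : ℝ} {K : ℕ}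
    (hK : 0 < K) (hρ0 : 0 < ρ) (hρ1 : ρ < 1) (hA : 0 ≤ A) (ha : ∀ k i, 0 ≤ a k i)
    (hd0 : 0 ≤ d K) (had : ∀ k, K ≤ k → ∀ i, a k i ^ 2 ≤ A * d k)
    (hmono : ∀ k n, K ≤ k → d (k + n) ≤ d k)
    (hcontr : ∀ q, 0 < q → d (q * K + K) ≤ ρ ^ (2 * K) * d (q * K)) :
    ∃ C : ℝ, ∀ k i, a k i ≤ C * ρ ^ k := by
  -- Counting starts at the end of the first window, because the dual objective may be infinite at
  -- its beginning.
  have hgeom (q : ℕ) : d ((q + 1) * K) ≤ ρ ^ (2 * K * q) * d K := by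
    induction q with
    | zero => simp
    | succ q ih =>
      have h1 := hcontr (q + 1) (Nat.succ_pos q)
      have h2 : (q + 1 + 1) * K = (q + 1) * K + K := by ring
      rw [h2]
      refine h1.trans ((mul_le_mul_of_nonneg_left ih (by positivity)).trans (le_of_eq ?_))
      rw [← mul_assoc, ← pow_add]
      ring_nf
  -- For k = K (q + 1) + r with r < K one has 2k ≤ 2Kq + 4K, hence the power `4 * K`. `C₂` covers
  -- the finitely many `k < K`.
  set C₁ := √(A * d K * (ρ ^ (4 * K))⁻¹) with hC₁
  set C₂ := ∑ k ∈ Finset.range K, ∑ i, a k i / ρ ^ k with hC₂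
  have hC₂0 : 0 ≤ C₂ := Finset.sum_nonneg fun k _ => Finset.sum_nonneg fun i _ =>
    div_nonneg (ha k i) (by positivity)
  have hC₁0 : 0 ≤ C₁ := Real.sqrt_nonneg _
  refine ⟨C₁ + C₂, fun k i => ?_⟩
  have hρk : 0 < ρ ^ k := by positivity
  rcases lt_or_ge k K with hk | hk
  · have h1 : a k i / ρ ^ k ≤ C₂ := by
      refine (Finset.single_le_sum (f := fun i => a k i / ρ ^ k)
        (fun i _ => div_nonneg (ha k i) hρk.le) (Finset.mem_univ i)).trans ?_
      exact Finset.single_le_sum (f := fun k => ∑ i, a k i / ρ ^ k)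
        (fun k _ => Finset.sum_nonneg fun i _ => div_nonneg (ha k i) (by positivity))
        (Finset.mem_range.2 hk)
    rw [← div_le_iff₀ hρk]
    linarith
  · obtain ⟨q, hq⟩ : ∃ q, k / K = q + 1 :=
      Nat.exists_eq_succ_of_ne_zero (Nat.div_pos hk hK).ne'
    have hdiv := Nat.div_add_mod k K
    have hmod := Nat.mod_lt k hK
    rw [hq] at hdiv
    have h1 : d k ≤ d ((q + 1) * K) := by
      have := hmono ((q + 1) * K) (k % K) (by nlinarith)
      rwa [mul_comm (q + 1), hdiv, mul_comm K] at this
    have h2 : ρ ^ (2 * K * q) ≤ (ρ ^ (4 * K))⁻¹ * (ρ ^ k) ^ 2 := by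
      rw [inv_mul_eq_div, le_div_iff₀ (by positivity), ← pow_add, ← pow_mul]
      exact pow_le_pow_of_le_one hρ0.le hρ1.le (by nlinarith)
    have h3 : a k i ^ 2 ≤ (C₁ * ρ ^ k) ^ 2 := by
      have hsq : C₁ ^ 2 = A * d K * (ρ ^ (4 * K))⁻¹ := Real.sq_sqrt (by positivity)
      rw [mul_pow, hsq]
      calc a k i ^ 2 ≤ A * d k := had k hk i
        _ ≤ A * (ρ ^ (2 * K * q) * d K) := mul_le_mul_of_nonneg_left (h1.trans (hgeom q)) hA
        _ ≤ A * ((ρ ^ (4 * K))⁻¹ * (ρ ^ k) ^ 2 * d K) := by gcongr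
        _ = _ := by ring
    have h4 := (sq_le_sq₀ (ha k i) (by positivity)).1 h3
    nlinarith [mul_nonneg hC₂0 hρk.le]

end Graph

end DistDyk

/-! ### The main theorem -/

theorem theorem3p4 {V : Type*} [Fintype V] [DecidableEq V] [Nonempty V]
    (E : Finset (V × V)) (hE : DistDyk.StronglyConnected E)
    (smin smax σ : ℝ) (hsmin : 0 < smin) (hsmax : 0 < smax) (hσ : 0 < σ)
    (K : ℕ) (hK : 0 < K) :
    ∃ γ₅ ρ : ℝ, 0 < γ₅ ∧ γ₅ < 1 ∧ 0 < ρ ∧ ρ < 1 ∧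
      ∀ (m : ℕ) (P : DistDyk.Problem V m), P.Smooth σ →
      ∀ (st : ℕ → DistDyk.State V E m) (ops : ℕ → List (DistDyk.Op V E)),
        DistDyk.IsRun P st ops → DistDyk.WeightsBounded smin smax st →
      ∃ (Fstar : ℝ) (xstar : DistDyk.X m),
        -- the dual optimal value is finite and does not depend on the iterate
        (∀ k, DistDyk.dualOpt P (st k).sAll = (Fstar : EReal)) ∧
        -- `xstar` is the unique minimizer of the primal problem
        (∀ w, w ≠ xstar → P.objective xstar < P.objective w) ∧
        -- every iterate comes from a dual variable
        (∀ k, ∃ z, (st k).Represents P z) ∧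
        -- linear contraction of the gap of the majorized dual objective
        (∀ k₀, DistDyk.IsWindow K ops k₀ →
          ∀ z z', (st k₀).Represents P z → (st (k₀ + K)).Represents P z' →
            (st (k₀ + K)).majObj P z' - (Fstar : EReal) ≤
              (γ₅ : EReal) * ((st k₀).majObj P z - (Fstar : EReal))) ∧
        -- the dual gap bounds the weighted distance to the minimizer
        (∀ k z, (st k).Represents P z →
          ((∑ α, (st k).sAll α / 2 * ‖xstar - (st k).x α‖ ^ 2 : ℝ) : EReal) ≤
            (st k).majObj P z - (Fstar : EReal)) ∧
        -- linear convergence of the primal iterates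
        ((∀ n, DistDyk.IsWindow K ops (n * K)) →
          ∃ C : ℝ, ∀ k i, ‖(st k).x (Sum.inl i) - xstar‖ ≤ C * ρ ^ k) := by
  obtain ⟨G, hG, hbound⟩ := DistDyk.exists_window_bound hE hsmin hσ hK
  -- This solves gap' ≤ G (gap - gap') for gap'.
  set γ := G / (1 + G) with hγ
  have hγ0 : 0 < γ := by positivity
  have hγ1 : γ < 1 := by rw [hγ, div_lt_one (by positivity)]; linarith
  have hK2 : 2 * K ≠ 0 := by omega
  -- A window of `K` iterations contracts the gap by `γ`, and distances are of the order of the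
  -- square root of the gap; hence the root of order `2 * K`.
  obtain ⟨ρ, hρ0, hργ⟩ : ∃ ρ : ℝ, 0 < ρ ∧ ρ ^ (2 * K) = γ :=
    ⟨γ ^ ((2 * K : ℕ) : ℝ)⁻¹, Real.rpow_pos_of_pos hγ0 _, Real.rpow_inv_natCast_pow hγ0.le hK2⟩
  have hρ1 : ρ < 1 := by
    by_contra! h
    exact absurd (one_le_pow₀ h : 1 ≤ ρ ^ (2 * K)) (by rw [hργ]; exact not_le.2 hγ1)
  refine ⟨γ, ρ, hγ0, hγ1, hρ0, hρ1, fun m P hP st ops hrun hw => ?_⟩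
  obtain ⟨x, hx⟩ := hP.exists_reduced_le
  have ha := hrun.admissible hP hσ
  have hcontr (k : ℕ) (hk : DistDyk.IsWindow K ops k) (hf : (st k).FiniteConj P) :
      (st (k + K)).dualVal P + P.reduced x ≤ γ * ((st k).dualVal P + P.reduced x) := by
    have h := hbound m P hP st ops hrun smax hw x hx k hk hf
    rw [hγ, div_mul_eq_mul_div, le_div_iff₀ (by positivity)]
    linarith
  have hgap {s : DistDyk.State V E m} (hs : s.Admissible P) (hf : s.FiniteConj P) {z}
      (hz : s.Represents P z) : s.majObj P z - ((-P.reduced x : ℝ) : EReal) =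
        ((s.dualVal P + P.reduced x : ℝ) : EReal) := by
    rw [hs.majObj_eq hf hz, ← EReal.coe_sub, sub_neg_eq_add]
  have hgap_top {s : DistDyk.State V E m} (hs : s.Admissible P) (hf : ¬ s.FiniteConj P) {z}
      (hz : s.Represents P z) : s.majObj P z - ((-P.reduced x : ℝ) : EReal) = ⊤ := by
    rw [hs.majObj_eq_top hf hz, EReal.top_sub_coe]
  refine ⟨-P.reduced x, x, fun k => ?_, fun w hwx => ?_, fun k => (ha k).exists_represents hE,
    fun k hk z z' hz hz' => ?_, fun k z hz => ?_, fun hwin => ?_⟩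
  · exact DistDyk.dualOpt_eq hE hP (ha k).s_nonneg (ha k).s_sum hx
  · have h1 := hP.reduced_add_sq_le hx w
    have h2 : 0 < ‖w - x‖ := norm_pos_iff.2 (sub_ne_zero.2 hwx)
    have hN : (0 : ℝ) < Fintype.card V := by exact_mod_cast Fintype.card_pos
    have h3 : 0 < Fintype.card V / 2 * ‖w - x‖ ^ 2 := by positivity
    rw [P.objective_eq, P.objective_eq]
    linarith
  · by_cases hf : (st k).FiniteConj P
    · rw [hgap (ha k) hf hz, hgap (ha _) (hrun.finiteConj hP hσ hf K) hz', ← EReal.coe_mul,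
        EReal.coe_le_coe_iff]
      exact hcontr k hk hf
    -- An infinite value at the start of the window makes the right side `⊤`, as `γ > 0`.
    · rw [hgap_top (ha k) hf hz, EReal.coe_mul_top_of_pos hγ0]
      exact le_top
  · by_cases hf : (st k).FiniteConj P
    · rw [hgap (ha k) hf hz, EReal.coe_le_coe_iff]
      simp only [norm_sub_rev x]
      exact (ha k).sum_sq_le hf x
    · rw [hgap_top (ha k) hf hz]
      exact le_top
  -- The first iteration performs C on all nodes, so all conjugates are finite from iterate 1 on,
  -- and 1 ≤ K.
  · have hfin (k : ℕ) (hk : K ≤ k) : (st k).FiniteConj P := by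
      have h0 : (st (0 + 1)).FiniteConj P := fun i =>
        (hrun.step 0).conj_ne_top hP hσ (ha 0)
          (Or.inl (by simpa using ((hwin 0).1 (DistDyk.Op.C i)).2 ⟨i, rfl⟩))
      have := hrun.finiteConj hP hσ h0 (k - 1)
      rwa [show 0 + 1 + (k - 1) = k by omega] at this
    have hsum (k : ℕ) (hk : K ≤ k) := (ha k).sum_sq_le (hfin k hk) x
    have hterm (k : ℕ) (α : DistDyk.Idx V E) :
        0 ≤ (st k).sAll α / 2 * ‖(st k).x α - x‖ ^ 2 := by
      have := (ha k).s_nonneg α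
      positivity
    refine DistDyk.exists_linear_bound (a := fun k i => ‖(st k).x (Sum.inl i) - x‖)
      (d := fun k => (st k).dualVal P + P.reduced x) (A := 2 / smin) hK hρ0 hρ1 (by positivity)
      (fun k i => norm_nonneg _) ?_ (fun k hk i => ?_) (fun k n hk => ?_) fun q hq => ?_
    · exact (Finset.sum_nonneg fun α _ => hterm K α).trans (hsum K le_rfl)
    -- Only the term of node `i` is kept; its weight is at least `smin`, hence the factor `2 /
    -- smin`.
    · have h1 := (Finset.single_le_sum (fun α _ => hterm k α)
        (Finset.mem_univ (Sum.inl i))).trans (hsum k hk)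
      have h2 : smin / 2 * ‖(st k).x (Sum.inl i) - x‖ ^ 2 ≤
          (st k).sAll (Sum.inl i) / 2 * ‖(st k).x (Sum.inl i) - x‖ ^ 2 := by
        have : smin ≤ (st k).sAll (Sum.inl i) := hrun.le_s hP hσ hw k i
        gcongr
      have h3 := h2.trans h1
      calc ‖(st k).x (Sum.inl i) - x‖ ^ 2
          = 2 / smin * (smin / 2 * ‖(st k).x (Sum.inl i) - x‖ ^ 2) := by field_simp
        _ ≤ _ := mul_le_mul_of_nonneg_left h3 (by positivity)
    · have := hrun.dualVal_le hP hσ hsmin hw (hfin k hk) n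
      change _ + _ ≤ _ + _
      linarith
    · rw [hργ]
      exact hcontr _ (hwin q) (hfin _ (Nat.le_mul_of_pos_left K hq))
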